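/- Let $(\mathcal X,\mathcal B_{\mathcal X})$ and $(\mathcal Y,\mathcal B_{\mathcal Y})$ be measurable spaces with countably generated $\sigma$-algebras, and let $(X^t,Y^t)_{t\ge 0}$ be a time-homogeneous Markov chain on $\mathcal X\times\mathcal Y$ (with the product $\sigma$-algebra); write $\mathbf P_{x,y}$, $\mathbf E_{x,y}$ for the chain started at $(x,y)$. For a Markov chain $(Z^t)$ and a measurable set $D$ of states let $\tau(D)=\min\{t\ge 1: Z^t\in D\}$; the set $D$ is called positive recurrent if $\tau(D)<\infty$ a.s. from every initial state $z$, and $\sup_{z\in D}\mathbf E_z\tau(D)<\infty$. Assume: (A0) $(X^t)$ is itself a Markov chain with autonomous dynamics: $\mathbf P_{x,y}(X^1\in\cdot)=\mathbf P_x(X^1\in\cdot)$ does not depend on $y$; (A1) the chain $(X^t)$ is aperiodic; (A2) there is a set $V\in\mathcal B_{\mathcal X}$ that is positive recurrent for $(X^t)$; (A3) $V$ admits a minorant measure: there are $0<p\le 1$, an integer $m\ge 1$ and a probability measure $\mu$ such that $\mathbf P_x(X^m\in\cdot)\ge p\,\mu(\cdot)$ for all $x\in V$. Let $\pi$ be the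 stationary distribution of $(X^t)$. Assume further: (B1) $L_2:\mathcal Y\to[0,\infty)$ is a measurable function with $\sup_{x\in\mathcal X,\,y\in\mathcal Y}\mathbf E_{x,y}|L_2(Y^1)-L_2(y)|<\infty$; (C) there are probability measures $H_x$, $x\in\mathcal X$, on $\mathbb R$ such that the law of $L_2(Y^1)-L_2(y)$ under $\mathbf P_{x,y}$ converges to $H_x$ weakly and in $\mathcal L_1$, uniformly in $x\in\mathcal X$, as $L_2(y)\to\infty$; that is, both the supremum over $x$ of the Lévy–Prokhorov distance between these two laws and the supremum over $x$ of their $\mathcal L_1$-distance (the infimum of $\mathbf E|\xi-\eta|$ over all couplings of $\xi$ and $\eta$ having these laws) tend to $0$ as $L_2(y)\to\infty$; (D) $\int_{\mathcal X}\pi(dx)\int_{\mathbb R}u\,H_x(du)<0$. Then the chain $(X^t,Y^t)$ is positive recurrent, in the sense that there is a number $N_0$ such that the set $V\times\{y\in\mathcal Y: L_2(y)\le N_0\}$ is positive recurrent for $(X^t,Y^t)$. -/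

import Mathlib

open MeasureTheory ProbabilityTheory Filter Topology
open scoped ENNReal

namespace AveragingLyapunov

section Chains

variable {Z : Type*} [MeasurableSpace Z]

/-- The conditional law of the state at time `n + 1` given the trajectory up to time `n`, for the
time-homogeneous Markov chain with transition kernel `P`: it depends on the state at time `n` only. -/
noncomputable def chainStep (P : Kernel Z Z) (n : ℕ) : Kernel (Finset.Iic n → Z) Z :=
  P.comap (fun h => h ⟨n, Finset.mem_Iic.2 le_rfl⟩) (measurable_pi_apply _)

instance chainStep_isMarkovKernel (P : Kernel Z Z) [IsMarkovKernel P] (n : ℕ) :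
    IsMarkovKernel (chainStep P n) := by
  unfold chainStep
  infer_instance

/-- The law of the whole trajectory `Z^0 = z, Z^1, Z^2, …` of the time-homogeneous Markov chain with
transition kernel `P` started at `z`. -/
noncomputable def pathLaw (P : Kernel Z Z) [IsMarkovKernel P] (z : Z) : Measure (ℕ → Z) :=
  Kernel.traj (X := fun _ => Z) (chainStep P) 0 (fun _ => z)

/-- The return time `τ(D) = min {t ≥ 1 : ω t ∈ D}`, equal to `∞` if there is no such `t`. -/
noncomputable def returnTime (D : Set Z) (ω : ℕ → Z) : ℕ∞ :=
  sInf ((fun t : ℕ => (t : ℕ∞)) '' {t : ℕ | 1 ≤ t ∧ ω t ∈ D})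

/-- The measurable set `D` is positive recurrent for the Markov chain with transition kernel `P`: the
return time to `D` is almost surely finite from every initial state, and its expectation is bounded
over the initial states in `D`. -/
def PositiveRecurrentSet (P : Kernel Z Z) [IsMarkovKernel P] (D : Set Z) : Prop :=
  MeasurableSet D ∧
  (∀ z, ∀ᵐ ω ∂(pathLaw P z), returnTime D ω < ⊤) ∧
  ⨆ z ∈ D, ∫⁻ ω, (returnTime D ω : ℝ≥0∞) ∂(pathLaw P z) < ⊤

/-- The set `V` admits a minorant measure: for some `0 < p ≤ 1`, some `m ≥ 1` and some probability
measure `μ`, one has `P_z(Z^m ∈ ·) ≥ p μ(·)` for all `z ∈ V`. -/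
def HasMinorant (P : Kernel Z Z) [IsMarkovKernel P] (V : Set Z) : Prop :=
  ∃ (p : ℝ≥0∞) (m : ℕ) (μ : Measure Z), 0 < p ∧ p ≤ 1 ∧ 1 ≤ m ∧ IsProbabilityMeasure μ ∧
    ∀ z ∈ V, p • μ ≤ (pathLaw P z).map (fun ω => ω m)

/-- Aperiodicity: for no `d ≥ 2` are there disjoint, not all empty, measurable sets
`C 0, …, C (d - 1)` through which the chain moves cyclically. (For a chain that is irreducible with
respect to some measure, the union of such a cycle is absorbing, hence automatically of full
measure.) -/
def Aperiodic (P : Kernel Z Z) : Prop :=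
  ∀ (d : ℕ) (C : ZMod d → Set Z), 2 ≤ d → (∀ i, MeasurableSet (C i)) →
    Pairwise (fun i j => Disjoint (C i) (C j)) →
    (∀ i, ∀ z ∈ C i, P z (C (i + 1)) = 1) → ∀ i, C i = ∅

end Chains

/-- The `L_1` (Kantorovich, or Wasserstein-1) distance of two laws on the real line: the infimum of
`E |ξ - η|` over all couplings of `ξ ∼ μ` and `η ∼ ν`. -/
noncomputable def lOneDist (μ ν : Measure ℝ) : ℝ≥0∞ :=
  ⨅ (γ : Measure (ℝ × ℝ)) (_ : γ.map Prod.fst = μ ∧ γ.map Prod.snd = ν),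
    ∫⁻ q, ENNReal.ofReal |q.1 - q.2| ∂γ

section TwoComponents

variable {X Y : Type*} [MeasurableSpace X] [MeasurableSpace Y]

/-- The law of `L (Y^1) - L y` under `P_{x,y}`. -/
noncomputable def incrementLaw (P : Kernel (X × Y) (X × Y)) (L : Y → ℝ) (x : X) (y : Y) :
    Measure ℝ :=
  (P (x, y)).map (fun z => L z.2 - L y)

end TwoComponents

end AveragingLyapunov

/-! Far out, the mean increment of `L₂` is close to a function h of `x` alone, which has no sign but
a negative `π`-mean. It is averaged out by a corrector `G ≥ 0` on `X` for which `W(x, y) = L₂ y + G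
x` has uniformly negative drift off a set that is easy to handle; a Foster argument then bounds the
mean return time.

The corrector solves the Poisson inequality `b + PX G ≤ G + c`, where `b ≥ 0` lies above h + c and
has `π`-mean below `c`. It is the value of optimal stopping with running reward `b - c`: the
increasing limit of `G ↦ (b + PX G - c)⁺` iterated from 0. Two arguments control it. Integrating the
recursion against `π` shows that it vanishes somewhere (`exists_stoppingValue_eq_zero`). Being
finite at one point, it is finite at some point of `V`; the minorant spreads this over `V`, and
excursions from `V` cost at most a constant times their mean length (`exists_stoppingValue_le`).

Negative drift is also needed where `L₂` is small but the mean return time r of the first component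
to `V` is large. Since r is finite `π`-a.e., a large penalty on `{r > M}` can be included in `b` at
small cost in mean. Only `{r ≤ M, L₂ ≤ N}` remains (`exists_lyapunov`). There `W` is bounded, and by
Markov's inequality the target set is reached within a fixed time with probability at least 1/2.

`W` may be infinite where r is, so almost sure return from arbitrary states is proved separately, by
waiting for the first component to enter `V` (`tendsto_avoidProb_of_fst`). -/

namespace AveragingLyapunov

/-! ### Killed transition operators and mean return times -/

section Taboo

variable {Z : Type*} [MeasurableSpace Z]

/-- The transition operator of the chain killed on entering `D`. -/
noncomputable def taboo (P : Kernel Z Z) (D : Set Z) (f : Z → ℝ≥0∞) (z : Z) : ℝ≥0∞ :=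
  ∫⁻ z', Dᶜ.indicator f z' ∂(P z)

/-- The probability that the chain started at `z` stays out of `D` at the times `1, …, k`. -/
noncomputable def avoidProb (P : Kernel Z Z) (D : Set Z) (k : ℕ) : Z → ℝ≥0∞ :=
  (taboo P D)^[k] 1

/-- The expected return time to `D`. -/
noncomputable def meanReturn (P : Kernel Z Z) (D : Set Z) (z : Z) : ℝ≥0∞ :=
  ∑' k, avoidProb P D k z

variable {P : Kernel Z Z} {D : Set Z}

lemma taboo_empty (f : Z → ℝ≥0∞) (z : Z) : taboo P ∅ f z = ∫⁻ z', f z' ∂(P z) := by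
  simp [taboo]

lemma taboo_mono {f g : Z → ℝ≥0∞} (h : f ≤ g) : taboo P D f ≤ taboo P D g := fun _ =>
  lintegral_mono fun _ => Set.indicator_le_indicator (h _)

lemma taboo_le_lintegral (f : Z → ℝ≥0∞) (z : Z) : taboo P D f z ≤ ∫⁻ z', f z' ∂(P z) :=
  lintegral_mono fun _ => Set.indicator_le_self _ _ _

lemma measurable_taboo (hD : MeasurableSet D) {f : Z → ℝ≥0∞} (hf : Measurable f) :
    Measurable (taboo P D f) :=
  (hf.indicator hD.compl).lintegral_kernel

lemma measurable_taboo_iterate (hD : MeasurableSet D) {f : Z → ℝ≥0∞} (hf : Measurable f) (k : ℕ) :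
    Measurable ((taboo P D)^[k] f) := by
  induction k with
  | zero => exact hf
  | succ k ih => rw [Function.iterate_succ_apply']; exact measurable_taboo hD ih

lemma taboo_iterate_mono {f g : Z → ℝ≥0∞} (h : f ≤ g) (k : ℕ) :
    (taboo P D)^[k] f ≤ (taboo P D)^[k] g :=
  Monotone.iterate (fun _ _ => taboo_mono) k h

lemma taboo_add (hD : MeasurableSet D) {f g : Z → ℝ≥0∞} (hf : Measurable f) :
    taboo P D (f + g) = taboo P D f + taboo P D g := by
  ext z
  simp only [taboo, Pi.add_apply, Set.indicator_add']
  exact lintegral_add_left (hf.indicator hD.compl) _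

lemma taboo_iterate_add (hD : MeasurableSet D) {f g : Z → ℝ≥0∞} (hf : Measurable f) (k : ℕ) :
    (taboo P D)^[k] (f + g) = (taboo P D)^[k] f + (taboo P D)^[k] g := by
  induction k with
  | zero => rfl
  | succ k ih =>
    rw [Function.iterate_succ_apply', ih, taboo_add hD (measurable_taboo_iterate hD hf k),
      Function.iterate_succ_apply', Function.iterate_succ_apply']

lemma taboo_const_mul (hD : MeasurableSet D) (c : ℝ≥0∞) {f : Z → ℝ≥0∞} (hf : Measurable f) :
    taboo P D (fun z => c * f z) = fun z => c * taboo P D f z := by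
  ext z
  simp only [taboo, Set.indicator_const_mul]
  exact lintegral_const_mul _ (hf.indicator hD.compl)

lemma taboo_iterate_const_mul (hD : MeasurableSet D) (c : ℝ≥0∞) {f : Z → ℝ≥0∞} (hf : Measurable f)
    (k : ℕ) : (taboo P D)^[k] (fun z => c * f z) = fun z => c * (taboo P D)^[k] f z := by
  induction k with
  | zero => rfl
  | succ k ih =>
    rw [Function.iterate_succ_apply', ih, taboo_const_mul hD _ (measurable_taboo_iterate hD hf k),
      Function.iterate_succ_apply']

lemma avoidProb_zero (z : Z) : avoidProb P D 0 z = 1 := rfl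

lemma avoidProb_succ (k : ℕ) : avoidProb P D (k + 1) = taboo P D (avoidProb P D k) :=
  Function.iterate_succ_apply' _ _ _

lemma measurable_avoidProb (hD : MeasurableSet D) (k : ℕ) : Measurable (avoidProb P D k) :=
  measurable_taboo_iterate hD measurable_one k

lemma measurable_meanReturn (hD : MeasurableSet D) : Measurable (meanReturn P D) :=
  Measurable.tsum (measurable_avoidProb hD)

lemma avoidProb_succ_le [IsMarkovKernel P] (k : ℕ) : avoidProb P D (k + 1) ≤ avoidProb P D k := by
  induction k with
  | zero =>
    intro z
    rw [avoidProb_succ]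
    refine (taboo_le_lintegral _ _).trans ?_
    simp [avoidProb]
  | succ k ih =>
    calc avoidProb P D (k + 1 + 1) = taboo P D (avoidProb P D (k + 1)) := avoidProb_succ _
      _ ≤ taboo P D (avoidProb P D k) := taboo_mono ih
      _ = avoidProb P D (k + 1) := (avoidProb_succ _).symm

lemma avoidProb_antitone [IsMarkovKernel P] (z : Z) : Antitone fun k => avoidProb P D k z :=
  antitone_nat_of_succ_le fun k => avoidProb_succ_le k z

lemma avoidProb_le_one [IsMarkovKernel P] (k : ℕ) (z : Z) : avoidProb P D k z ≤ 1 :=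
  avoidProb_antitone z (Nat.zero_le k)

lemma sum_avoidProb_succ (hD : MeasurableSet D) (n : ℕ) (z : Z) :
    ∑ k ∈ Finset.range (n + 1), avoidProb P D k z
      = 1 + taboo P D (fun z' => ∑ k ∈ Finset.range n, avoidProb P D k z') z := by
  rw [Finset.sum_range_succ', avoidProb_zero, add_comm]
  congr 1
  simp only [avoidProb_succ, taboo]
  rw [← lintegral_finsetSum]
  · refine lintegral_congr fun z' => ?_
    by_cases h : z' ∈ Dᶜ <;> simp [h]
  · exact fun k _ => (measurable_avoidProb hD k).indicator hD.compl

/-- First-step analysis: one step is always spent, and the count continues only if that step misses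
`D`. -/
lemma meanReturn_eq (hD : MeasurableSet D) (z : Z) :
    meanReturn P D z = 1 + taboo P D (meanReturn P D) z := by
  rw [meanReturn, tsum_eq_zero_add' ENNReal.summable, avoidProb_zero]
  congr 1
  simp only [avoidProb_succ, taboo]
  rw [← lintegral_tsum]
  · refine lintegral_congr fun z' => ?_
    by_cases h : z' ∈ Dᶜ <;> simp [h, meanReturn]
  · exact fun k => ((measurable_avoidProb hD k).indicator hD.compl).aemeasurable

lemma nat_mul_avoidProb_le_meanReturn [IsMarkovKernel P] (k : ℕ) (z : Z) :
    k * avoidProb P D k z ≤ meanReturn P D z :=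
  calc k * avoidProb P D k z = ∑ _i ∈ Finset.range k, avoidProb P D k z := by simp
    _ ≤ ∑ i ∈ Finset.range k, avoidProb P D i z :=
        Finset.sum_le_sum fun i hi => avoidProb_antitone z (Finset.mem_range.1 hi).le
    _ ≤ meanReturn P D z := ENNReal.sum_le_tsum _

end Taboo

/-! ### From path measures to iterated operators -/

section PathLaw

lemma returnTime_le_iff {Z : Type*} {D : Set Z} (ω : ℕ → Z) (k : ℕ) :
    returnTime D ω ≤ k ↔ ∃ i, 1 ≤ i ∧ i ≤ k ∧ ω i ∈ D := by
  constructor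
  · intro h
    have hlt : returnTime D ω < ((k + 1 : ℕ) : ℕ∞) :=
      h.trans_lt (by exact_mod_cast Nat.lt_succ_self k)
    obtain ⟨_, ⟨i, ⟨h1, h2⟩, rfl⟩, hi⟩ := sInf_lt_iff.1 hlt
    exact ⟨i, h1, Nat.lt_succ_iff.1 (Nat.cast_lt.1 hi), h2⟩
  · rintro ⟨i, h1, h2, h3⟩
    have h4 : returnTime D ω ≤ (i : ℕ∞) := sInf_le ⟨i, ⟨h1, h3⟩, rfl⟩
    exact h4.trans (Nat.cast_le.2 h2)

lemma lt_returnTime_iff {Z : Type*} {D : Set Z} (ω : ℕ → Z) (k : ℕ) :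
    (k : ℕ∞) < returnTime D ω ↔ ∀ i, 1 ≤ i → i ≤ k → ω i ∉ D := by
  rw [← not_le, returnTime_le_iff]; push Not; rfl

variable {Z : Type*} [MeasurableSpace Z] (P : Kernel Z Z) [IsMarkovKernel P] {D : Set Z}

lemma measurableSet_avoid (hD : MeasurableSet D) (k : ℕ) :
    MeasurableSet {ω : ℕ → Z | ∀ i, 1 ≤ i → i ≤ k → ω i ∉ D} := by
  simp only [Set.ofPred_forall]
  exact MeasurableSet.iInter fun i => MeasurableSet.iInter fun _ => MeasurableSet.iInter fun _ =>
    (measurable_pi_apply i : Measurable fun ω : ℕ → Z => ω i) hD.compl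

/-- The bridge between trajectories and operators. With `g = 1` it gives the tails of the return
time; with `D = ∅` it gives the `k`-step law. -/
lemma setLIntegral_pathLaw_avoid (hD : MeasurableSet D) (z : Z) (k : ℕ) {g : Z → ℝ≥0∞}
    (hg : Measurable g) :
    ∫⁻ ω in {ω : ℕ → Z | ∀ i, 1 ≤ i → i ≤ k → ω i ∉ D}, g (ω k) ∂(pathLaw P z)
      = (taboo P D)^[k] g z := by
  induction k generalizing g with
  | zero =>
    have h1 : {ω : ℕ → Z | ∀ i, 1 ≤ i → i ≤ 0 → ω i ∉ D} = Set.univ := by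
      ext ω; simp only [Set.mem_ofPred_eq, Set.mem_univ, iff_true]; intro i h1 h2; omega
    have hm : Measurable fun h : Finset.Iic 0 → Z => g (h ⟨0, Finset.mem_Iic.2 le_rfl⟩) :=
      hg.comp (measurable_pi_apply _)
    have h2 := Kernel.traj_map_frestrictLe_apply (X := fun _ => Z) (κ := chainStep P) 0 0
      (fun _ => z)
    rw [h1, Measure.restrict_univ, Function.iterate_zero, id]
    have h3 := lintegral_map (μ := pathLaw P z) hm
      (Preorder.measurable_frestrictLe (X := fun _ => Z) 0)
    have h4 : ∫⁻ ω, g (ω 0) ∂(pathLaw P z)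
        = ∫⁻ ω, g ((Preorder.frestrictLe (π := fun _ => Z) 0 ω) ⟨0, Finset.mem_Iic.2 le_rfl⟩)
          ∂(pathLaw P z) := rfl
    rw [h4, ← h3, pathLaw, h2, Kernel.partialTraj_self, Kernel.id_apply, lintegral_dirac' _ hm]
  | succ k ih =>
    set A : Set (Finset.Iic k → Z) := {h | ∀ i : Finset.Iic k, 1 ≤ i.1 → h i ∉ D} with hA
    have hAm : MeasurableSet A := by
      simp only [hA, Set.ofPred_forall]
      exact MeasurableSet.iInter fun i => MeasurableSet.iInter fun _ =>
        (measurable_pi_apply i : Measurable fun h : Finset.Iic k → Z => h i) hD.compl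
    have hpre : (Preorder.frestrictLe (π := fun _ => Z) k) ⁻¹' A
        = {ω : ℕ → Z | ∀ i, 1 ≤ i → i ≤ k → ω i ∉ D} := by
      ext ω
      simp only [hA, Set.mem_preimage, Set.mem_ofPred_eq]
      exact ⟨fun h i h1 h2 => h ⟨i, Finset.mem_Iic.2 h2⟩ h1,
        fun h i h1 => h i.1 h1 (Finset.mem_Iic.1 i.2)⟩
    let F : (Finset.Iic k → Z) × Z → ℝ≥0∞ := fun q => A.indicator 1 q.1 * Dᶜ.indicator g q.2
    have hF : Measurable F :=
      ((measurable_one.indicator hAm).comp measurable_fst).mul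
        ((hg.indicator hD.compl).comp measurable_snd)
    have hone := Kernel.partialTraj_compProd_eq_map_traj (X := fun _ => Z) (κ := chainStep P)
      (Nat.zero_le k) (x₀ := fun _ => z)
    have hL : ∫⁻ ω in {ω : ℕ → Z | ∀ i, 1 ≤ i → i ≤ k + 1 → ω i ∉ D}, g (ω (k + 1)) ∂(pathLaw P z)
        = ∫⁻ q, F q ∂((pathLaw P z).map
            (fun x => (Preorder.frestrictLe (π := fun _ => Z) k x, x (k + 1)))) := by
      rw [lintegral_map hF (by fun_prop), ← lintegral_indicator (measurableSet_avoid hD _)]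
      refine lintegral_congr fun ω => ?_
      have hmem : ω ∈ {ω : ℕ → Z | ∀ i, 1 ≤ i → i ≤ k + 1 → ω i ∉ D} ↔
          Preorder.frestrictLe (π := fun _ => Z) k ω ∈ A ∧ ω (k + 1) ∈ Dᶜ := by
        rw [← Set.mem_preimage, hpre]
        refine ⟨fun h => ⟨fun i h1 h2 => h i h1 (by omega), h _ (by omega) le_rfl⟩, ?_⟩
        rintro ⟨h1, h2⟩ i hi hik
        rcases Nat.lt_or_ge k i with h | h
        · rwa [show i = k + 1 by omega]
        · exact h1 i hi h
      by_cases h1 : Preorder.frestrictLe (π := fun _ => Z) k ω ∈ A <;>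
      by_cases h2 : ω (k + 1) ∈ Dᶜ <;> simp only [Set.indicator, hmem, h1, h2, F] <;> simp
    rw [hL, pathLaw, ← hone, Measure.lintegral_compProd hF]
    have hin : ∀ h : Finset.Iic k → Z, ∫⁻ z', F (h, z') ∂(chainStep P k h)
        = A.indicator (fun h => taboo P D g (h ⟨k, Finset.mem_Iic.2 le_rfl⟩)) h := by
      intro h
      simp only [F]
      rw [lintegral_const_mul _ (hg.indicator hD.compl)]
      by_cases hh : h ∈ A <;> simp [hh, taboo, chainStep]
    simp only [hin]
    -- The last step of the path is integrated out first, which replaces `g` by `taboo P D g`; hence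
    -- the induction over all `g`.
    rw [lintegral_indicator hAm, Function.iterate_succ_apply, ← ih (measurable_taboo hD hg),
      ← Kernel.traj_map_frestrictLe_apply, setLIntegral_map hAm _ (by fun_prop), hpre]
    · rfl
    · exact (measurable_taboo hD hg).comp (measurable_pi_apply _)

lemma pathLaw_lt_returnTime (hD : MeasurableSet D) (z : Z) (k : ℕ) :
    pathLaw P z {ω | (k : ℕ∞) < returnTime D ω} = avoidProb P D k z := by
  rw [avoidProb, ← setLIntegral_pathLaw_avoid P hD z k measurable_one]
  simp [lt_returnTime_iff]

lemma coe_eq_tsum_lt (n : ℕ∞) : (n : ℝ≥0∞) = ∑' k : ℕ, if (k : ℕ∞) < n then 1 else 0 := by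
  induction n using ENat.recTopCoe with
  | top => simp
  | coe n =>
    rw [tsum_eq_sum (s := Finset.range n)]
    · rw [Finset.sum_congr rfl (g := fun _ => 1)]
      · simp
      · intro k hk
        simpa using hk
    · intro k hk
      simpa using hk

lemma lintegral_returnTime (hD : MeasurableSet D) (z : Z) :
    ∫⁻ ω, (returnTime D ω : ℝ≥0∞) ∂(pathLaw P z) = meanReturn P D z := by
  have hm : ∀ k : ℕ, MeasurableSet {ω : ℕ → Z | (k : ℕ∞) < returnTime D ω} := fun k => by
    simp only [lt_returnTime_iff]
    exact measurableSet_avoid hD k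
  have h : ∀ ω : ℕ → Z, (returnTime D ω : ℝ≥0∞)
      = ∑' k : ℕ, {ω : ℕ → Z | (k : ℕ∞) < returnTime D ω}.indicator 1 ω := fun ω => by
    rw [coe_eq_tsum_lt]
    simp [Set.indicator]
  simp only [h]
  rw [lintegral_tsum fun k => (measurable_one.indicator (hm k)).aemeasurable, meanReturn]
  exact tsum_congr fun k => by rw [lintegral_indicator_one (hm k), pathLaw_lt_returnTime P hD]

instance (z : Z) : IsProbabilityMeasure (pathLaw P z) := by
  unfold pathLaw; infer_instance

lemma ae_returnTime_lt_top_iff (hD : MeasurableSet D) (z : Z) :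
    (∀ᵐ ω ∂(pathLaw P z), returnTime D ω < ⊤) ↔
      Tendsto (fun k => avoidProb P D k z) atTop (𝓝 0) := by
  have hm : ∀ k : ℕ, MeasurableSet {ω : ℕ → Z | (k : ℕ∞) < returnTime D ω} := fun k => by
    simp only [lt_returnTime_iff]
    exact measurableSet_avoid hD k
  have hset : {ω : ℕ → Z | ¬ returnTime D ω < ⊤}
      = ⋂ k : ℕ, {ω : ℕ → Z | (k : ℕ∞) < returnTime D ω} := by
    ext ω
    simp only [Set.mem_ofPred_eq, Set.mem_iInter, not_lt, top_le_iff]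
    exact ⟨fun h k => h ▸ ENat.natCast_lt_top k, ENat.eq_top_iff_forall_gt.2⟩
  have hlim := tendsto_measure_iInter_atTop (μ := pathLaw P z)
    (s := fun k : ℕ => {ω : ℕ → Z | (k : ℕ∞) < returnTime D ω})
    (fun k => (hm k).nullMeasurableSet)
    (fun i j hij ω (hω : (j : ℕ∞) < _) => lt_of_le_of_lt (by exact_mod_cast hij) hω)
    ⟨0, measure_ne_top _ _⟩
  simp only [Function.comp_def, pathLaw_lt_returnTime P hD] at hlim
  rw [ae_iff, hset]
  exact ⟨fun h => h ▸ hlim, fun h => tendsto_nhds_unique hlim h⟩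

lemma positiveRecurrentSet_iff :
    PositiveRecurrentSet P D ↔ MeasurableSet D ∧
      (∀ z, Tendsto (fun k => avoidProb P D k z) atTop (𝓝 0)) ∧
      ⨆ z ∈ D, meanReturn P D z < ⊤ := by
  refine and_congr_right fun hD => ?_
  simp only [ae_returnTime_lt_top_iff P hD, lintegral_returnTime P hD]

lemma lintegral_map_pathLaw (z : Z) (m : ℕ) {g : Z → ℝ≥0∞} (hg : Measurable g) :
    ∫⁻ z', g z' ∂((pathLaw P z).map fun ω => ω m) = (taboo P ∅)^[m] g z := by
  rw [lintegral_map hg (measurable_pi_apply m),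
    ← setLIntegral_pathLaw_avoid P MeasurableSet.empty z m hg]
  simp

end PathLaw

/-! ### Optimal stopping and its stationary mean -/

section StoppingValue

variable {X : Type*} [MeasurableSpace X]

/-- The value of the optimal stopping problem with horizon `n` and reward `b - c` per step. -/
noncomputable def stoppingValue (K : Kernel X X) (b : X → ℝ≥0∞) (c : ℝ≥0∞) : ℕ → X → ℝ≥0∞
  | 0 => 0
  | n + 1 => fun x => b x + ∫⁻ x', stoppingValue K b c n x' ∂(K x) - c

variable {K : Kernel X X} {b : X → ℝ≥0∞} {c : ℝ≥0∞}

lemma measurable_stoppingValue (hb : Measurable b) (n : ℕ) :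
    Measurable (stoppingValue K b c n) := by
  induction n with
  | zero => exact measurable_zero
  | succ n ih => exact (hb.add ih.lintegral_kernel).sub_const c

lemma stoppingValue_le_succ (n : ℕ) : stoppingValue K b c n ≤ stoppingValue K b c (n + 1) := by
  induction n with
  | zero => exact fun _ => zero_le
  | succ n ih => exact fun x => tsub_le_tsub_right (add_le_add_right (lintegral_mono ih) _) _

lemma stoppingValue_monotone : Monotone (stoppingValue K b c) :=
  monotone_nat_of_le_succ stoppingValue_le_succ

lemma stoppingValue_le [IsMarkovKernel K] {β : ℝ≥0∞} (hβ : ∀ x, b x ≤ β) (n : ℕ) (x : X) :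
    stoppingValue K b c n x ≤ n * β := by
  induction n generalizing x with
  | zero => exact zero_le
  | succ n ih =>
    calc stoppingValue K b c (n + 1) x ≤ b x + ∫⁻ x', stoppingValue K b c n x' ∂(K x) :=
          tsub_le_self
      _ ≤ β + ∫⁻ _, n * β ∂(K x) := add_le_add (hβ x) (lintegral_mono ih)
      _ = (n + 1 : ℕ) * β := by simp; ring

/-- Truncated subtraction in the recursion is the positive part, so discarding it leaves an
inequality, which passes to the limit by monotone convergence. -/
lemma add_lintegral_iSup_stoppingValue (hb : Measurable b) (x : X) :
    b x + ∫⁻ x', ⨆ n, stoppingValue K b c n x' ∂(K x) ≤ (⨆ n, stoppingValue K b c n x) + c := by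
  rw [lintegral_iSup (measurable_stoppingValue hb) stoppingValue_monotone, ENNReal.add_iSup]
  refine iSup_le fun n => ?_
  calc b x + ∫⁻ x', stoppingValue K b c n x' ∂(K x) ≤ stoppingValue K b c (n + 1) x + c :=
        le_tsub_add
    _ ≤ _ := add_le_add_left (le_iSup (fun n => stoppingValue K b c n x) _) _

/-- If the reward has negative mean in the stationary regime, the optimal stopping value vanishes
somewhere. -/
lemma exists_stoppingValue_eq_zero [IsMarkovKernel K] (hb : Measurable b) {β : ℝ≥0∞}
    (hβ : ∀ x, b x ≤ β) (hβt : β ≠ ⊤) {π : Measure X} [IsProbabilityMeasure π]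
    (hπ : K.Invariant π) (hbc : ∫⁻ x, b x ∂π < c) :
    ∃ x, ∀ n, stoppingValue K b c n x = 0 := by
  have hG := measurable_stoppingValue (K := K) (c := c) hb
  -- Split t = (t - c)⁺ + min(c, t) with t = b + K Gₙ, where Gₙ is the value at horizon `n`, so that
  -- (t - c)⁺ = Gₙ₊₁. By invariance ∫ K Gₙ dπ = ∫ Gₙ dπ ≤ ∫ Gₙ₊₁ dπ, and the finite ∫ Gₙ₊₁ dπ
  -- cancels.
  have hstep : ∀ n, ∫⁻ x, min c (b x + ∫⁻ x', stoppingValue K b c n x' ∂(K x)) ∂π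
      ≤ ∫⁻ x, b x ∂π := by
    intro n
    have hfin : ∫⁻ x, stoppingValue K b c (n + 1) x ∂π ≠ ⊤ := by
      refine ne_top_of_le_ne_top ?_ (lintegral_mono (stoppingValue_le hβ (n + 1)))
      simp [ENNReal.mul_eq_top, hβt]
    have hinv : ∫⁻ x, ∫⁻ x', stoppingValue K b c n x' ∂(K x) ∂π
        = ∫⁻ x, stoppingValue K b c n x ∂π := by
      conv_rhs => rw [← hπ.def]
      exact (Measure.lintegral_bind K.measurable.aemeasurable (hG n).aemeasurable).symm
    refine (ENNReal.add_le_add_iff_left hfin).1 ?_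
    calc ∫⁻ x, stoppingValue K b c (n + 1) x ∂π
          + ∫⁻ x, min c (b x + ∫⁻ x', stoppingValue K b c n x' ∂(K x)) ∂π
        = ∫⁻ x, (b x + ∫⁻ x', stoppingValue K b c n x' ∂(K x)) ∂π := by
          rw [← lintegral_add_left (hG _)]
          refine lintegral_congr fun x => ?_
          change b x + ∫⁻ x', stoppingValue K b c n x' ∂(K x) - c + _ = _
          rw [min_comm]
          rcases le_total c (b x + ∫⁻ x', stoppingValue K b c n x' ∂(K x)) with h | h
          · rw [min_eq_right h, tsub_add_cancel_of_le h]
          · rw [min_eq_left h, tsub_eq_zero_of_le h, zero_add]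
      _ = ∫⁻ x, b x ∂π + ∫⁻ x, stoppingValue K b c n x ∂π := by
          rw [lintegral_add_left hb, hinv]
      _ ≤ ∫⁻ x, b x ∂π + ∫⁻ x, stoppingValue K b c (n + 1) x ∂π :=
          add_le_add_right (lintegral_mono (stoppingValue_le_succ n)) _
      _ = _ := add_comm _ _
  have hlim : ∫⁻ x, ⨆ n, min c (b x + ∫⁻ x', stoppingValue K b c n x' ∂(K x)) ∂π
      ≤ ∫⁻ x, b x ∂π := by
    rw [lintegral_iSup]
    · exact iSup_le hstep
    · exact fun n => measurable_const.min (hb.add (hG n).lintegral_kernel)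
    · exact fun i j hij x => min_le_min_left _
        (add_le_add_right (lintegral_mono (stoppingValue_monotone hij)) _)
  -- If the value were positive everywhere, the minimum would reach `c` at every point for some `n`,
  -- and its limit would have mean at least `c`.
  by_contra! hne
  refine absurd (hlim.trans_lt hbc) (not_lt.2 ?_)
  calc c = ∫⁻ _, c ∂π := by simp
    _ ≤ _ := lintegral_mono fun x => ?_
  obtain ⟨n, hn⟩ := hne x
  cases n with
  | zero => exact absurd rfl hn
  | succ n =>
    have h : c ≤ b x + ∫⁻ x', stoppingValue K b c n x' ∂(K x) := by
      by_contra! h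
      exact hn (tsub_eq_zero_of_le h.le)
    exact le_trans (by simp [h])
      (le_iSup (fun n => min c (b x + ∫⁻ x', stoppingValue K b c n x' ∂(K x))) n)

end StoppingValue

/-! ### Finiteness of the stopping value and the Poisson inequality -/

section Recurrence

variable {X : Type*} [MeasurableSpace X] {K : Kernel X X} [IsMarkovKernel K] {V F : Set X}

/-- A nonempty absorbing set meets every set that the chain visits almost surely. -/
lemma exists_mem_of_absorbing {x : X} (hF : ∀ z ∈ F, ∀ᵐ z' ∂(K z), z' ∈ F) (hx : x ∈ F)
    (hV : Tendsto (fun k => avoidProb K V k x) atTop (𝓝 0)) : (F ∩ V).Nonempty := by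
  by_contra hne
  have hdis : ∀ z ∈ F, z ∈ Vᶜ := fun z hz hzV => hne ⟨z, hz, hzV⟩
  have h1 : ∀ k, ∀ z ∈ F, avoidProb K V k z = 1 := by
    intro k
    induction k with
    | zero => exact fun z _ => rfl
    | succ k ih =>
      intro z hz
      rw [avoidProb_succ, taboo]
      calc ∫⁻ z', Vᶜ.indicator (avoidProb K V k) z' ∂(K z) = ∫⁻ _, 1 ∂(K z) := by
            refine lintegral_congr_ae ((hF z hz).mono fun z' hz' => ?_)
            simp only [Set.indicator_of_mem (hdis z' hz'), ih z' hz']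
        _ = 1 := by simp
  simp only [h1 _ x hx] at hV
  exact one_ne_zero (tendsto_nhds_unique tendsto_const_nhds hV)

lemma lintegral_meanReturn_ne_top (hVm : MeasurableSet V) {T : ℝ≥0∞} (hTt : T ≠ ⊤)
    (hT : ∀ x ∈ V, meanReturn K V x ≤ T) {x : X} (hx : meanReturn K V x ≠ ⊤) :
    ∫⁻ x', meanReturn K V x' ∂(K x) ≠ ⊤ := by
  rw [meanReturn_eq hVm x] at hx
  have h : ∫⁻ x', meanReturn K V x' ∂(K x) ≤ taboo K V (meanReturn K V) x + T := by
    calc ∫⁻ x', meanReturn K V x' ∂(K x)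
        ≤ ∫⁻ x', (Vᶜ.indicator (meanReturn K V) x' + T) ∂(K x) := by
          refine lintegral_mono fun x' => ?_
          by_cases h : x' ∈ V
          · exact (hT x' h).trans le_add_self
          · rw [Set.indicator_of_mem (show x' ∈ Vᶜ from h)]; exact le_self_add
      _ = taboo K V (meanReturn K V) x + T := by
          rw [lintegral_add_right _ measurable_const]; simp [taboo]
  exact ne_top_of_le_ne_top
    (ENNReal.add_ne_top.2 ⟨(ENNReal.add_ne_top.1 hx).2, hTt⟩) h

/-- States with finite mean return time almost surely lead only to such states. So being in the bad
set `S` at time `n` forces a stay in `S`, hence outside `V`, at all times up to `n`. Under `π` the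
first event has constant probability `π S`, while the probability of avoiding `V` tends to 0. -/
lemma ae_meanReturn_ne_top (hVm : MeasurableSet V)
    (hV : ∀ x, Tendsto (fun k => avoidProb K V k x) atTop (𝓝 0)) {T : ℝ≥0∞} (hTt : T ≠ ⊤)
    (hT : ∀ x ∈ V, meanReturn K V x ≤ T) {π : Measure X} [IsProbabilityMeasure π]
    (hπ : K.Invariant π) : ∀ᵐ x ∂π, meanReturn K V x ≠ ⊤ := by
  set S : Set X := {x | meanReturn K V x = ⊤} with hS
  have hSm : MeasurableSet S := measurable_meanReturn hVm (measurableSet_singleton ⊤)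
  have hSV : ∀ x ∈ S, x ∈ Vᶜ := fun x hx hxV =>
    hTt (top_le_iff.1 ((show meanReturn K V x = ⊤ from hx) ▸ hT x hxV))
  set e : ℕ → X → ℝ≥0∞ := fun n => (taboo K ∅)^[n] (S.indicator 1) with he
  have hem : ∀ n, Measurable (e n) := fun n =>
    measurable_taboo_iterate MeasurableSet.empty (measurable_one.indicator hSm) n
  have hes : ∀ n x, e (n + 1) x = ∫⁻ x', e n x' ∂(K x) := fun n x => by
    simp only [he, Function.iterate_succ_apply', taboo_empty]
  have hout : ∀ n, ∀ x ∉ S, e n x = 0 := by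
    intro n
    induction n with
    | zero => exact fun x hx => Set.indicator_of_notMem hx _
    | succ n ih =>
      intro x hx
      rw [hes]
      have hae := ae_lt_top (measurable_meanReturn hVm) (lintegral_meanReturn_ne_top hVm hTt hT hx)
      rw [lintegral_congr_ae (hae.mono fun x' hx' => ih x' hx'.ne), lintegral_zero]
  have hle : ∀ n x, e n x ≤ avoidProb K V n x := by
    intro n
    induction n with
    | zero => exact fun x => Set.indicator_le_self _ _ _
    | succ n ih =>
      intro x
      rw [hes, avoidProb_succ]
      refine lintegral_mono fun x' => ?_
      by_cases hx' : x' ∈ S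
      · rw [Set.indicator_of_mem (hSV x' hx')]; exact ih x'
      · simp only [hout n x' hx', zero_le]
  have hconst : ∀ n, ∫⁻ x, e n x ∂π = π S := by
    intro n
    induction n with
    | zero => exact lintegral_indicator_one hSm
    | succ n ih =>
      simp only [hes]
      rw [← Measure.lintegral_bind K.measurable.aemeasurable (hem n).aemeasurable, hπ.def, ih]
  have hlim : Tendsto (fun n => ∫⁻ x, avoidProb K V n x ∂π) atTop (𝓝 0) := by
    have := tendsto_lintegral_of_dominated_convergence (μ := π) (F := fun n x => avoidProb K V n x)
      (f := fun _ => 0) (fun _ => 1) (measurable_avoidProb hVm)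
      (fun n => Eventually.of_forall fun x => avoidProb_le_one n x) (by simp)
      (Eventually.of_forall hV)
    simpa using this
  have h0 : π S ≤ 0 := ge_of_tendsto' hlim fun n => hconst n ▸ lintegral_mono (hle n)
  rw [ae_iff]
  simpa [hS] using h0

/-- The optimal stopping value is finite, and bounded by the mean return time to a recurrent set
with a minorant, as soon as it is finite somewhere. -/
lemma exists_stoppingValue_le (hVm : MeasurableSet V)
    (hV : ∀ x, Tendsto (fun k => avoidProb K V k x) atTop (𝓝 0)) {T : ℝ≥0∞} (hTt : T ≠ ⊤)
    (hT : ∀ x ∈ V, meanReturn K V x ≤ T) (hmin : HasMinorant K V)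
    {b : X → ℝ≥0∞} (hb : Measurable b) {β : ℝ≥0∞} (hβ : ∀ x, b x ≤ β) (hβt : β ≠ ⊤)
    {c : ℝ≥0∞} (hct : c ≠ ⊤) {x₁ : X} (hx₁ : ∀ n, stoppingValue K b c n x₁ = 0) :
    ∃ a : ℝ≥0∞, a ≠ ⊤ ∧ ∀ n x, stoppingValue K b c n x ≤ β * meanReturn K V x + a := by
  obtain ⟨p, m, μ, hp0, hp1, -, hμ, hmin⟩ := hmin
  have hpt : p ≠ ⊤ := ne_top_of_le_ne_top ENNReal.one_ne_top hp1
  set G : X → ℝ≥0∞ := fun x => ⨆ n, stoppingValue K b c n x with hGdef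
  have hGn := measurable_stoppingValue (K := K) (c := c) hb
  have hGm : Measurable G := Measurable.iSup hGn
  have hKG : ∀ x, ∫⁻ x', G x' ∂(K x) ≤ G x + c := fun x =>
    le_add_self.trans (add_lintegral_iSup_stoppingValue hb x)
  -- By `hKG` the set where `G` is finite is absorbing, and it contains `x₁`.
  obtain ⟨x₀, hx₀, hx₀V⟩ : ({x | G x ≠ ⊤} ∩ V).Nonempty := by
    refine exists_mem_of_absorbing (K := K) (x := x₁) ?_ ?_ (hV x₁)
    · intro z hz
      have : ∫⁻ x', G x' ∂(K z) ≠ ⊤ :=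
        ne_top_of_le_ne_top (ENNReal.add_ne_top.2 ⟨hz, hct⟩) (hKG z)
      exact (ae_lt_top hGm this).mono fun x' hx' => hx'.ne
    · simp [hGdef, hx₁]
  have hiter : ∀ j x, (taboo K ∅)^[j] G x ≤ G x + j * c := by
    intro j
    induction j with
    | zero => intro x; simp
    | succ j ih =>
      intro x
      rw [Function.iterate_succ_apply', taboo_empty]
      calc ∫⁻ x', (taboo K ∅)^[j] G x' ∂(K x) ≤ ∫⁻ x', (G x' + j * c) ∂(K x) := lintegral_mono ih
        _ = ∫⁻ x', G x' ∂(K x) + j * c := by rw [lintegral_add_right _ measurable_const]; simp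
        _ ≤ G x + c + j * c := add_le_add_left (hKG x) _
        _ = G x + (j + 1 : ℕ) * c := by push_cast; ring
  -- The `m`-step law from `x₀` dominates `p • μ`, and the `m`-step mean of `G` from `x₀` is finite.
  have hμG : p * ∫⁻ x, G x ∂μ ≠ ⊤ := by
    have h : p * ∫⁻ x, G x ∂μ ≤ G x₀ + m * c := by
      calc p * ∫⁻ x, G x ∂μ = ∫⁻ x, G x ∂(p • μ) := by rw [lintegral_smul_measure, smul_eq_mul]
        _ ≤ ∫⁻ x, G x ∂((pathLaw K x₀).map fun ω => ω m) := lintegral_mono' (hmin x₀ hx₀V) le_rfl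
        _ = (taboo K ∅)^[m] G x₀ := lintegral_map_pathLaw K x₀ m hGm
        _ ≤ _ := hiter m x₀
    exact ne_top_of_le_ne_top
      (ENNReal.add_ne_top.2 ⟨hx₀, ENNReal.mul_ne_top (ENNReal.natCast_ne_top m) hct⟩) h
  set u : X → ℝ≥0∞ := Vᶜ.indicator (meanReturn K V) with hu
  have hum : Measurable u := (measurable_meanReturn hVm).indicator hVm.compl
  have hru : ∀ x, meanReturn K V x = 1 + ∫⁻ x', u x' ∂(K x) := fun x => meanReturn_eq hVm x
  have huiter : ∀ j, ∀ x, (taboo K ∅)^[j] u x ≤ u x + j * T := by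
    intro j
    induction j with
    | zero => intro x; simp
    | succ j ih =>
      intro x
      rw [Function.iterate_succ_apply', taboo_empty]
      have hKu : ∫⁻ x', u x' ∂(K x) ≤ u x + T := by
        have h := hru x
        by_cases hx : x ∈ V
        · exact (le_add_self.trans (h ▸ hT x hx)).trans le_add_self
        · rw [hu, Set.indicator_of_mem (show x ∈ Vᶜ from hx), h]
          exact le_add_self.trans le_self_add
      calc ∫⁻ x', (taboo K ∅)^[j] u x' ∂(K x) ≤ ∫⁻ x', (u x' + j * T) ∂(K x) := lintegral_mono ih
        _ = ∫⁻ x', u x' ∂(K x) + j * T := by rw [lintegral_add_right _ measurable_const]; simp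
        _ ≤ u x + T + j * T := add_le_add_left hKu _
        _ = u x + (j + 1 : ℕ) * T := by push_cast; ring
  have hGiter : ∀ n j x,
      stoppingValue K b c n x ≤ j * β + (taboo K ∅)^[j] (stoppingValue K b c n) x := by
    intro n j
    induction j with
    | zero => intro x; simp
    | succ j ih =>
      intro x
      rw [Function.iterate_succ_apply', taboo_empty]
      calc stoppingValue K b c n x ≤ stoppingValue K b c (n + 1) x := stoppingValue_le_succ n x
        _ ≤ b x + ∫⁻ x', stoppingValue K b c n x' ∂(K x) := tsub_le_self
        _ ≤ β + ∫⁻ x', (j * β + (taboo K ∅)^[j] (stoppingValue K b c n) x') ∂(K x) :=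
            add_le_add (hβ x) (lintegral_mono ih)
        _ = (j + 1 : ℕ) * β + ∫⁻ x', (taboo K ∅)^[j] (stoppingValue K b c n) x' ∂(K x) := by
            rw [lintegral_add_left measurable_const]; simp; ring
  set a : ℕ → ℝ≥0∞ := fun n => ⨆ x ∈ V, stoppingValue K b c n x with ha
  have hat : ∀ n, a n ≠ ⊤ := fun n => ne_top_of_le_ne_top
    (ENNReal.mul_ne_top (ENNReal.natCast_ne_top n) hβt)
    (iSup₂_le fun x _ => stoppingValue_le hβ n x)
  -- Until `V` is entered each step earns at most `β`, and from then on at most `a n`. Off `V` the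
  -- induction closes because `u = 1 + K u` there.
  have hGu : ∀ n, ∀ k ≤ n, ∀ x, stoppingValue K b c k x ≤ β * u x + a n := by
    intro n k
    induction k with
    | zero => exact fun _ x => zero_le
    | succ k ih =>
      intro hk x
      by_cases hx : x ∈ V
      · calc stoppingValue K b c (k + 1) x ≤ stoppingValue K b c n x := stoppingValue_monotone hk x
          _ ≤ a n := le_iSup₂ (f := fun x (_ : x ∈ V) => stoppingValue K b c n x) x hx
          _ ≤ _ := le_add_self
      · calc stoppingValue K b c (k + 1) x ≤ b x + ∫⁻ x', stoppingValue K b c k x' ∂(K x) :=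
              tsub_le_self
          _ ≤ β + ∫⁻ x', (β * u x' + a n) ∂(K x) :=
              add_le_add (hβ x) (lintegral_mono (ih (by omega)))
          _ = β * (1 + ∫⁻ x', u x' ∂(K x)) + a n := by
              rw [lintegral_add_right _ measurable_const, lintegral_const_mul _ hum]; simp; ring
          _ = β * u x + a n := by
              rw [← hru, hu, Set.indicator_of_mem (show x ∈ Vᶜ from hx)]
  set B : ℝ≥0∞ := m * β + p * ∫⁻ x, G x ∂μ + β * (m * T) with hB
  have hBt : B ≠ ⊤ := by
    refine ENNReal.add_ne_top.2 ⟨ENNReal.add_ne_top.2 ⟨?_, hμG⟩, ?_⟩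
    · exact ENNReal.mul_ne_top (ENNReal.natCast_ne_top m) hβt
    · exact ENNReal.mul_ne_top hβt (ENNReal.mul_ne_top (ENNReal.natCast_ne_top m) hTt)
  -- After `m` steps from `V`, the part `p • μ` of the law contributes a bounded amount by `hμG`;
  -- only the remaining mass `1 - p` can see `a n`. As `a n` is finite for each `n`, it can be
  -- absorbed on the left.
  have hcontr : ∀ n, a n ≤ B + (1 - p) * a n := by
    intro n
    refine iSup₂_le fun x hx => ?_
    set ν : Measure X := (pathLaw K x).map fun ω => ω m with hν
    have hνp : IsProbabilityMeasure ν :=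
      Measure.isProbabilityMeasure_map (measurable_pi_apply m).aemeasurable
    have hfin : IsFiniteMeasure (p • μ) := ⟨by simpa using hpt.lt_top⟩
    have hdec : ν - p • μ + p • μ = ν := Measure.sub_add_cancel_of_le (hmin x hx)
    have hmass : (ν - p • μ) Set.univ = 1 - p := by
      have h := congrArg (fun ρ : Measure X => ρ Set.univ) hdec
      simp only [Measure.add_apply, Measure.smul_apply, measure_univ, smul_eq_mul, mul_one] at h
      exact ENNReal.eq_sub_of_add_eq hpt h
    have hrest : ∫⁻ x', stoppingValue K b c n x' ∂(ν - p • μ) ≤ β * (m * T) + (1 - p) * a n := by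
      calc ∫⁻ x', stoppingValue K b c n x' ∂(ν - p • μ)
          ≤ ∫⁻ x', (β * u x' + a n) ∂(ν - p • μ) := lintegral_mono (hGu n n le_rfl)
        _ = β * ∫⁻ x', u x' ∂(ν - p • μ) + a n * (1 - p) := by
            rw [lintegral_add_right _ measurable_const, lintegral_const_mul _ hum, lintegral_const,
              hmass]
        _ ≤ β * ∫⁻ x', u x' ∂ν + a n * (1 - p) := by
            gcongr
            exact Measure.sub_le
        _ ≤ β * (m * T) + (1 - p) * a n := by
            rw [mul_comm (a n), lintegral_map_pathLaw K x m hum]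
            gcongr
            have := huiter m x
            rwa [hu, Set.indicator_of_notMem (show x ∉ Vᶜ from fun h => h hx), zero_add] at this
    calc stoppingValue K b c n x ≤ m * β + (taboo K ∅)^[m] (stoppingValue K b c n) x :=
          hGiter n m x
      _ = m * β + (∫⁻ x', stoppingValue K b c n x' ∂(ν - p • μ)
            + p * ∫⁻ x', stoppingValue K b c n x' ∂μ) := by
          rw [← lintegral_map_pathLaw K x m (hGn n), ← hν]
          conv_lhs => rw [← hdec]
          rw [lintegral_add_measure, lintegral_smul_measure, smul_eq_mul]
      _ ≤ m * β + (β * (m * T) + (1 - p) * a n + p * ∫⁻ x', G x' ∂μ) := by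
          gcongr with x'
          exact le_iSup (fun n => stoppingValue K b c n x') n
      _ = B + (1 - p) * a n := by rw [hB]; ring
  have hbound : ∀ n, a n ≤ B / p := by
    intro n
    rw [ENNReal.le_div_iff_mul_le (Or.inl hp0.ne') (Or.inl hpt)]
    have h : a n = (1 - p) * a n + p * a n := by rw [← add_mul, tsub_add_cancel_of_le hp1, one_mul]
    have h2 := hcontr n
    nth_rewrite 1 [h] at h2
    rw [add_comm B] at h2
    rw [mul_comm]
    exact (ENNReal.add_le_add_iff_left
      (ENNReal.mul_ne_top (ne_top_of_le_ne_top ENNReal.one_ne_top tsub_le_self) (hat n))).1 h2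
  refine ⟨B / p, ENNReal.div_ne_top hBt hp0.ne', fun n x => ?_⟩
  calc stoppingValue K b c n x ≤ β * u x + a n := hGu n n le_rfl x
    _ ≤ β * meanReturn K V x + B / p := by
        gcongr
        · exact Set.indicator_le_self _ _ _
        · exact hbound n

/-- Existence of a nonnegative solution of the Poisson inequality. -/
lemma exists_poisson_supersolution (hVm : MeasurableSet V)
    (hV : ∀ x, Tendsto (fun k => avoidProb K V k x) atTop (𝓝 0)) {T : ℝ≥0∞} (hTt : T ≠ ⊤)
    (hT : ∀ x ∈ V, meanReturn K V x ≤ T) (hmin : HasMinorant K V)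
    {π : Measure X} [IsProbabilityMeasure π] (hπ : K.Invariant π)
    {b : X → ℝ≥0∞} (hb : Measurable b) {β : ℝ≥0∞} (hβ : ∀ x, b x ≤ β) (hβt : β ≠ ⊤)
    {c : ℝ≥0∞} (hct : c ≠ ⊤) (hbc : ∫⁻ x, b x ∂π < c) :
    ∃ (G : X → ℝ≥0∞) (a : ℝ≥0∞), Measurable G ∧ a ≠ ⊤ ∧
      (∀ x, b x + ∫⁻ x', G x' ∂(K x) ≤ G x + c) ∧ ∀ x, G x ≤ β * meanReturn K V x + a := by
  obtain ⟨x₁, hx₁⟩ := exists_stoppingValue_eq_zero hb hβ hβt hπ hbc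
  obtain ⟨a, hat, ha⟩ := exists_stoppingValue_le hVm hV hTt hT hmin hb hβ hβt hct hx₁
  exact ⟨fun x => ⨆ n, stoppingValue K b c n x, a, Measurable.iSup (measurable_stoppingValue hb),
    hat, add_lintegral_iSup_stoppingValue hb, fun x => iSup_le fun n => ha n x⟩

end Recurrence

/-! ### Foster-type drift criterion -/

section Foster

variable {Z : Type*} [MeasurableSpace Z] {P : Kernel Z Z} [IsMarkovKernel P] {D S : Set Z}

/-- The Markov property at time `s`: the first `s` steps cost at most `s`, and the rest counts only
on paths still avoiding `D`. -/
lemma sum_avoidProb_le_taboo_iterate (hD : MeasurableSet D) (n s : ℕ) (z : Z) :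
    ∑ k ∈ Finset.range (s + n), avoidProb P D k z
      ≤ s + (taboo P D)^[s] (fun z' => ∑ k ∈ Finset.range n, avoidProb P D k z') z := by
  induction s generalizing z with
  | zero => simp
  | succ s ih =>
    rw [show s + 1 + n = s + n + 1 by omega, sum_avoidProb_succ hD, Function.iterate_succ_apply']
    set g := (taboo P D)^[s] fun z' => ∑ k ∈ Finset.range n, avoidProb P D k z' with hg
    calc 1 + taboo P D (fun z' => ∑ k ∈ Finset.range (s + n), avoidProb P D k z') z
        ≤ 1 + taboo P D ((fun _ => (s : ℝ≥0∞)) + g) z := by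
          gcongr
          exact taboo_mono ih z
      _ = 1 + (taboo P D (fun _ => (s : ℝ≥0∞)) z + taboo P D g z) := by
          rw [taboo_add hD measurable_const, Pi.add_apply]
      _ ≤ 1 + (s + taboo P D g z) := by
          gcongr
          exact (taboo_le_lintegral _ _).trans (by simp)
      _ = (s + 1 : ℕ) + taboo P D g z := by push_cast; ring

/-- A drift criterion: if `W` decreases on average by one unit off `S`, and `D` is reached from `S`
within a fixed time with probability at least `1 / 2`, then the mean return time to `D` is bounded
by `W` up to a constant. -/
lemma exists_meanReturn_le_of_unit_drift (hD : MeasurableSet D) {W : Z → ℝ≥0∞} (hW : Measurable W)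
    {B w : ℝ≥0∞} (hBt : B ≠ ⊤) (hwt : w ≠ ⊤) {s : ℕ}
    (hdrift : ∀ z ∉ S, ∫⁻ z', W z' ∂(P z) + 1 ≤ W z)
    (hgrow : ∀ z, ∫⁻ z', W z' ∂(P z) ≤ W z + B) (hWS : ∀ z ∈ S, W z ≤ w)
    (hs : ∀ z ∈ S, avoidProb P D s z ≤ 2⁻¹) :
    ∃ Q : ℝ≥0∞, Q ≠ ⊤ ∧ ∀ z, meanReturn P D z ≤ W z + Q := by
  -- Return times truncated at `n` keep the suprema `q n` over `S` finite, so that the self-bound `q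
  -- n ≤ R + q n / 2` can be solved.
  set U : ℕ → Z → ℝ≥0∞ := fun n z => ∑ k ∈ Finset.range n, avoidProb P D k z with hU
  have hUmono : ∀ {i j}, i ≤ j → ∀ z, U i z ≤ U j z := fun hij z =>
    Finset.sum_le_sum_of_subset (Finset.range_mono hij)
  set q : ℕ → ℝ≥0∞ := fun n => ⨆ z ∈ S, U n z with hq
  have hqU : ∀ n, ∀ z ∈ S, U n z ≤ q n := fun n z hz =>
    le_iSup₂ (f := fun z (_ : z ∈ S) => U n z) z hz
  have hqt : ∀ n, q n ≠ ⊤ := fun n => by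
    refine ne_top_of_le_ne_top (ENNReal.natCast_ne_top n) (iSup₂_le fun z _ => ?_)
    calc U n z ≤ ∑ _k ∈ Finset.range n, 1 := Finset.sum_le_sum fun k _ => avoidProb_le_one k z
      _ = n := by simp
  have hUW : ∀ n, ∀ k ≤ n, ∀ z, U k z ≤ W z + q n := by
    intro n k
    induction k with
    | zero => intro _ z; simp [hU]
    | succ k ih =>
      intro hk z
      by_cases hz : z ∈ S
      · exact ((hUmono hk z).trans (hqU n z hz)).trans le_add_self
      · calc U (k + 1) z = 1 + taboo P D (U k) z := sum_avoidProb_succ hD k z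
          _ ≤ 1 + ∫⁻ z', (W z' + q n) ∂(P z) := by
              gcongr
              exact (taboo_le_lintegral _ _).trans (lintegral_mono (ih (by omega)))
          _ = ∫⁻ z', W z' ∂(P z) + 1 + q n := by
              rw [lintegral_add_right _ measurable_const]; simp; ring
          _ ≤ W z + q n := by gcongr; exact hdrift z hz
  have hWiter : ∀ j z, (taboo P D)^[j] W z ≤ W z + j * B := by
    intro j
    induction j with
    | zero => intro z; simp
    | succ j ih =>
      intro z
      rw [Function.iterate_succ_apply']
      calc taboo P D ((taboo P D)^[j] W) z ≤ ∫⁻ z', (W z' + j * B) ∂(P z) :=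
            (taboo_le_lintegral _ _).trans (lintegral_mono ih)
        _ = ∫⁻ z', W z' ∂(P z) + j * B := by rw [lintegral_add_right _ measurable_const]; simp
        _ ≤ W z + B + j * B := by gcongr; exact hgrow z
        _ = W z + (j + 1 : ℕ) * B := by push_cast; ring
  set R : ℝ≥0∞ := s + (w + s * B) with hR
  have hRt : R ≠ ⊤ := by
    simp [hR, hwt, hBt, ENNReal.mul_eq_top]
  have hqle : ∀ n, q n ≤ R + q n * 2⁻¹ := by
    intro n
    refine iSup₂_le fun z hz => ?_
    calc U n z ≤ U (s + n) z := hUmono (by omega) z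
      _ ≤ s + (taboo P D)^[s] (U n) z := sum_avoidProb_le_taboo_iterate hD n s z
      _ ≤ s + (taboo P D)^[s] (W + fun z => q n * (1 : Z → ℝ≥0∞) z) z := by
          gcongr
          exact taboo_iterate_mono (fun z' => by simpa using hUW n n le_rfl z') s z
      _ = s + ((taboo P D)^[s] W z + q n * avoidProb P D s z) := by
          rw [taboo_iterate_add hD hW, taboo_iterate_const_mul hD _ measurable_one]; rfl
      _ ≤ s + ((w + s * B) + q n * 2⁻¹) := by
          gcongr
          · exact (hWiter s z).trans (by gcongr; exact hWS z hz)
          · exact hs z hz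
      _ = R + q n * 2⁻¹ := by rw [hR]; ring
  have hqR : ∀ n, q n ≤ R * 2 := by
    intro n
    have h := hqle n
    have hsplit : q n = q n * 2⁻¹ + q n * 2⁻¹ := by
      rw [← mul_add, ENNReal.inv_two_add_inv_two, mul_one]
    nth_rewrite 1 [hsplit] at h
    have hh : q n * 2⁻¹ ≤ R :=
      (ENNReal.add_le_add_iff_right (ENNReal.mul_ne_top (hqt n) (by simp))).1 h
    calc q n = q n * 2⁻¹ * 2 := by
          rw [mul_assoc, ENNReal.inv_mul_cancel two_ne_zero ENNReal.ofNat_ne_top, mul_one]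
      _ ≤ R * 2 := by gcongr
  refine ⟨R * 2, ENNReal.mul_ne_top hRt ENNReal.ofNat_ne_top, fun z => ?_⟩
  rw [meanReturn, ENNReal.tsum_eq_iSup_nat]
  exact iSup_le fun n => (hUW n n le_rfl z).trans (by gcongr; exact hqR n)

/-- Rescaling `W` by `δ⁻¹` reduces to unit drift. -/
lemma exists_meanReturn_le_of_drift (hD : MeasurableSet D) {W : Z → ℝ≥0∞} (hW : Measurable W)
    {δ B w : ℝ≥0∞} (hδ0 : δ ≠ 0) (hδt : δ ≠ ⊤) (hBt : B ≠ ⊤) (hwt : w ≠ ⊤) {s : ℕ}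
    (hdrift : ∀ z ∉ S, ∫⁻ z', W z' ∂(P z) + δ ≤ W z)
    (hgrow : ∀ z, ∫⁻ z', W z' ∂(P z) ≤ W z + B) (hWS : ∀ z ∈ S, W z ≤ w)
    (hs : ∀ z ∈ S, avoidProb P D s z ≤ 2⁻¹) :
    ∃ Q : ℝ≥0∞, Q ≠ ⊤ ∧ ∀ z, meanReturn P D z ≤ δ⁻¹ * W z + Q := by
  have hit : δ⁻¹ ≠ ⊤ := ENNReal.inv_ne_top.2 hδ0
  refine exists_meanReturn_le_of_unit_drift (S := S) hD (W := fun z => δ⁻¹ * W z) (B := δ⁻¹ * B)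
    (w := δ⁻¹ * w) (hW.const_mul _) (ENNReal.mul_ne_top hit hBt) (ENNReal.mul_ne_top hit hwt)
    (fun z hz => ?_) (fun z => ?_) (fun z hz => by gcongr; exact hWS z hz) hs
  · rw [lintegral_const_mul _ hW, ← ENNReal.inv_mul_cancel hδ0 hδt, ← mul_add]
    gcongr
    exact hdrift z hz
  · rw [lintegral_const_mul _ hW, ← mul_add]
    gcongr
    exact hgrow z

end Foster

/-! ### Hitting product sets through the first component -/

section TwoComponents

variable {X Y : Type*} [MeasurableSpace X] [MeasurableSpace Y]
  {P : Kernel (X × Y) (X × Y)} {PX : Kernel X X}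
  {V : Set X} {D : Set (X × Y)}

lemma lintegral_fst_eq (hauto : ∀ x y, (P (x, y)).map Prod.fst = PX x) {f : X → ℝ≥0∞}
    (hf : Measurable f) (x : X) (y : Y) : ∫⁻ z, f z.1 ∂(P (x, y)) = ∫⁻ x', f x' ∂(PX x) := by
  rw [← hauto x y, lintegral_map hf measurable_fst]

/-- If `V` is visited almost surely by the first component, and `D` is visited almost surely by
the pair from every state over `V`, then `D` is visited almost surely from every state. -/
lemma tendsto_avoidProb_of_fst [IsMarkovKernel P]
    (hauto : ∀ x y, (P (x, y)).map Prod.fst = PX x)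
    (hVm : MeasurableSet V) (hD : MeasurableSet D)
    (hV : ∀ x, Tendsto (fun k => avoidProb PX V k x) atTop (𝓝 0))
    (hVD : ∀ z : X × Y, z.1 ∈ V → Tendsto (fun k => avoidProb P D k z) atTop (𝓝 0)) (z : X × Y) :
    Tendsto (fun k => avoidProb P D k z) atTop (𝓝 0) := by
  set φ : X × Y → ℝ≥0∞ := fun z => ⨅ k, avoidProb P D k z with hφ
  have hlim : ∀ z, Tendsto (fun k => avoidProb P D k z) atTop (𝓝 (φ z)) := fun z =>
    tendsto_atTop_iInf (avoidProb_antitone z)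
  -- The probability `φ` of never returning is subharmonic and vanishes over `V`; iterating until
  -- the first component enters `V` bounds it by `avoidProb PX V k`.
  have hsub : ∀ z, φ z ≤ ∫⁻ z', φ z' ∂(P z) := by
    intro z
    rw [hφ, lintegral_iInf (measurable_avoidProb hD) (fun i j hij z => avoidProb_antitone z hij)]
    · refine le_iInf fun k => (iInf_le _ (k + 1)).trans ?_
      rw [avoidProb_succ]
      exact taboo_le_lintegral _ _
    · simp [avoidProb_zero]
  have hle : ∀ k z, φ z ≤ avoidProb PX V k z.1 := by
    intro k
    induction k with
    | zero => exact fun z => (iInf_le _ 0).trans le_rfl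
    | succ k ih =>
      rintro ⟨x, y⟩
      refine (hsub _).trans ?_
      rw [avoidProb_succ, taboo,
        ← lintegral_fst_eq hauto ((measurable_avoidProb hVm k).indicator hVm.compl) x y]
      refine lintegral_mono fun z' => ?_
      by_cases hz' : z'.1 ∈ V
      · rw [tendsto_nhds_unique (hlim z') (hVD z' hz')]; exact zero_le
      · rw [Set.indicator_of_mem (show z'.1 ∈ Vᶜ from hz')]; exact ih z'
  have h0 : φ z = 0 := le_antisymm (ge_of_tendsto' (hV z.1) fun k => hle k z) zero_le
  exact h0 ▸ hlim z

/-- The probability of avoiding `V ×ˢ {L ≤ N}` up to time `k` is at most that of avoiding `V` plus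
a Markov-type bound for the second component. -/
lemma avoidProb_prod_le [IsMarkovKernel P] (hauto : ∀ x y, (P (x, y)).map Prod.fst = PX x)
    (hVm : MeasurableSet V) {L : Y → ℝ} (hL : Measurable L)
    {C : ℝ≥0∞} (hgrow : ∀ x y, ∫⁻ z, ENNReal.ofReal (L z.2) ∂(P (x, y)) ≤ ENNReal.ofReal (L y) + C)
    {N : ℝ} (hN : 0 < N) (k : ℕ) (x : X) (y : Y) :
    avoidProb P (V ×ˢ {y | L y ≤ N}) k (x, y)
      ≤ avoidProb PX V k x + (ENNReal.ofReal (L y) + k * C) / ENNReal.ofReal N := by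
  induction k generalizing x y with
  | zero => exact le_self_add
  | succ k ih =>
    have hNpos : ENNReal.ofReal N ≠ 0 := by simpa using hN
    have hmf : Measurable fun z : X × Y => Vᶜ.indicator (avoidProb PX V k) z.1 :=
      ((measurable_avoidProb hVm k).indicator hVm.compl).comp measurable_fst
    have hml : Measurable fun z : X × Y => ENNReal.ofReal (L z.2) :=
      (hL.comp measurable_snd).ennreal_ofReal
    calc avoidProb P (V ×ˢ {y | L y ≤ N}) (k + 1) (x, y)
        = taboo P (V ×ˢ {y | L y ≤ N}) (avoidProb P (V ×ˢ {y | L y ≤ N}) k) (x, y) := by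
          rw [avoidProb_succ]
      _ ≤ ∫⁻ z, (Vᶜ.indicator (avoidProb PX V k) z.1
            + (ENNReal.ofReal (L z.2) + k * C) / ENNReal.ofReal N) ∂(P (x, y)) := by
          refine lintegral_mono fun z => ?_
          by_cases hz : z ∈ (V ×ˢ {y | L y ≤ N} : Set (X × Y))
          · rw [Set.indicator_of_notMem (Set.notMem_compl_iff.2 hz)]; exact zero_le
          rw [Set.indicator_of_mem (show z ∈ (V ×ˢ {y | L y ≤ N} : Set (X × Y))ᶜ from hz)]
          -- Entering `V` without entering the product set means `L > N`, and the trivial bound 1 is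
          -- then at most `L / N`.
          by_cases hzV : z.1 ∈ V
          · have hLz : N < L z.2 := by
              by_contra! h
              exact hz ⟨hzV, h⟩
            refine (avoidProb_le_one k z).trans (le_trans ?_ le_add_self)
            rw [ENNReal.le_div_iff_mul_le (Or.inl hNpos) (Or.inl ENNReal.ofReal_ne_top), one_mul]
            exact (ENNReal.ofReal_le_ofReal hLz.le).trans le_self_add
          · rw [Set.indicator_of_mem (show z.1 ∈ Vᶜ from hzV)]
            exact ih z.1 z.2
      _ = avoidProb PX V (k + 1) x
            + (∫⁻ z, ENNReal.ofReal (L z.2) ∂(P (x, y)) + k * C) / ENNReal.ofReal N := by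
          rw [lintegral_add_left hmf, avoidProb_succ, taboo,
            lintegral_fst_eq hauto ((measurable_avoidProb hVm k).indicator hVm.compl)]
          simp only [div_eq_mul_inv]
          rw [lintegral_mul_const _ (hml.add_const _), lintegral_add_right _ measurable_const]
          simp
      _ ≤ avoidProb PX V (k + 1) x
            + (ENNReal.ofReal (L y) + C + k * C) / ENNReal.ofReal N := by
          gcongr
          exact hgrow x y
      _ = _ := by push_cast; ring_nf

end TwoComponents

/-! ### Mean increments and their limits -/

section Drift

/-- A coupling of cost below `ε` compares the means. It also makes the identity integrable under
`ν`, as first coordinate minus difference. -/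
lemma abs_integral_sub_le_of_lOneDist_lt {μ ν : Measure ℝ} (hμ : Integrable (fun u => u) μ) {ε : ℝ}
    (h : lOneDist μ ν < ENNReal.ofReal ε) : |∫ u, u ∂μ - ∫ u, u ∂ν| ≤ ε := by
  obtain ⟨γ, h⟩ := iInf_lt_iff.1 h
  obtain ⟨hγ, hlt⟩ := iInf_lt_iff.1 h
  obtain ⟨rfl, rfl⟩ := hγ
  have h1 : Integrable (fun q : ℝ × ℝ => q.1) γ :=
    (integrable_map_measure aestronglyMeasurable_id measurable_fst.aemeasurable).1 hμ
  have h12 : Integrable (fun q : ℝ × ℝ => q.1 - q.2) γ := by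
    refine ⟨(measurable_fst.sub measurable_snd).aestronglyMeasurable, ?_⟩
    rw [hasFiniteIntegral_iff_norm]
    exact hlt.trans ENNReal.ofReal_lt_top
  have h2 : Integrable (fun q : ℝ × ℝ => q.2) γ := by
    refine (h1.sub h12).congr (Eventually.of_forall fun q => ?_)
    simp
  rw [integral_map (f := fun u : ℝ => u) measurable_fst.aemeasurable aestronglyMeasurable_id,
    integral_map (f := fun u : ℝ => u) measurable_snd.aemeasurable aestronglyMeasurable_id,
    ← integral_sub h1 h2]
  have hε : 0 < ε := ENNReal.ofReal_pos.1 (lt_of_le_of_lt zero_le hlt)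
  rw [← Real.norm_eq_abs]
  exact (norm_integral_le_lintegral_norm _).trans (ENNReal.toReal_le_of_le_ofReal hε.le hlt.le)

variable {X Y : Type*} [MeasurableSpace X] [MeasurableSpace Y]
  {P : Kernel (X × Y) (X × Y)} {L : Y → ℝ}

lemma integrable_increment (hL : Measurable L) {C : ℝ} {x : X} {y : Y}
    (hC : ∫⁻ z, ENNReal.ofReal |L z.2 - L y| ∂(P (x, y)) ≤ ENNReal.ofReal C) :
    Integrable (fun z => L z.2 - L y) (P (x, y)) := by
  refine ⟨((hL.comp measurable_snd).sub_const _).aestronglyMeasurable, ?_⟩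
  rw [hasFiniteIntegral_iff_norm]
  exact hC.trans_lt ENNReal.ofReal_lt_top

lemma abs_integral_increment_le {C : ℝ} (hC0 : 0 ≤ C) {x : X} {y : Y}
    (hC : ∫⁻ z, ENNReal.ofReal |L z.2 - L y| ∂(P (x, y)) ≤ ENNReal.ofReal C) :
    |∫ z, (L z.2 - L y) ∂(P (x, y))| ≤ C := by
  rw [← Real.norm_eq_abs]
  exact (norm_integral_le_lintegral_norm _).trans (ENNReal.toReal_le_of_le_ofReal hC0 hC)

lemma add_integral_increment_eq [IsMarkovKernel P] (hL : Measurable L) {C : ℝ} {x : X} {y : Y}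
    (hC : ∫⁻ z, ENNReal.ofReal |L z.2 - L y| ∂(P (x, y)) ≤ ENNReal.ofReal C) :
    Integrable (fun z => L z.2) (P (x, y)) ∧
      L y + ∫ z, (L z.2 - L y) ∂(P (x, y)) = ∫ z, L z.2 ∂(P (x, y)) := by
  have hint : Integrable (fun z : X × Y => L z.2) (P (x, y)) := by
    refine ((integrable_increment hL hC).add (integrable_const (L y))).congr
      (Eventually.of_forall fun z => ?_)
    simp
  refine ⟨hint, ?_⟩
  rw [integral_sub hint (integrable_const _)]
  simp

lemma lintegral_ofReal_snd_eq [IsMarkovKernel P] (hL0 : ∀ y, 0 ≤ L y) (hL : Measurable L)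
    {C : ℝ} {x : X} {y : Y}
    (hC : ∫⁻ z, ENNReal.ofReal |L z.2 - L y| ∂(P (x, y)) ≤ ENNReal.ofReal C) :
    ∫⁻ z, ENNReal.ofReal (L z.2) ∂(P (x, y))
      = ENNReal.ofReal (L y + ∫ z, (L z.2 - L y) ∂(P (x, y))) := by
  obtain ⟨hint, heq⟩ := add_integral_increment_eq hL hC
  rw [heq, ofReal_integral_eq_lintegral_ofReal hint (Eventually.of_forall fun z => hL0 z.2)]

/-- The drift of `L` far away is dominated by a bounded measurable function of the first component
with negative mean in the stationary regime. -/
lemma exists_drift_majorant [IsMarkovKernel P] (hL : Measurable L) {C : ℝ} (hC0 : 0 ≤ C)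
    (hC : ∀ x y, ∫⁻ z, ENNReal.ofReal |L z.2 - L y| ∂(P (x, y)) ≤ ENNReal.ofReal C)
    {π : Measure X} [IsProbabilityMeasure π] {H : X → Measure ℝ}
    (hLone : Tendsto (fun y => ⨆ x, lOneDist (incrementLaw P L x y) (H x)) (comap L atTop) (𝓝 0))
    (hneg : ∫ x, ∫ u, u ∂(H x) ∂π < 0) :
    ∃ (δ A N : ℝ) (h : X → ℝ), 0 < δ ∧ Measurable h ∧ (∀ x, |h x| ≤ A) ∧
      ∫ x, h x ∂π ≤ -(4 * δ) ∧
      ∀ x y, N ≤ L y → ∫ z, (L z.2 - L y) ∂(P (x, y)) ≤ h x + δ := by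
  set κ : ℝ := -∫ x, ∫ u, u ∂(H x) ∂π with hκ
  have hκ0 : 0 < κ := by linarith
  have hev : ∀ᶠ y in comap L atTop, ⨆ x, lOneDist (incrementLaw P L x y) (H x)
      < ENNReal.ofReal (κ / 16) :=
    hLone.eventually (gt_mem_nhds (by simpa using hκ0))
  rw [eventually_comap] at hev
  obtain ⟨N, hN⟩ := eventually_atTop.1 hev
  have hclose : ∀ x y, N ≤ L y →
      |∫ z, (L z.2 - L y) ∂(P (x, y)) - ∫ u, u ∂(H x)| ≤ κ / 16 := by
    intro x y hy
    have hlt := (le_iSup (fun x => lOneDist (incrementLaw P L x y) (H x)) x).trans_lt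
      (hN (L y) hy y rfl)
    have hm : Measurable fun z : X × Y => L z.2 - L y := (hL.comp measurable_snd).sub_const _
    have h := abs_integral_sub_le_of_lOneDist_lt ?_ hlt
    · rwa [incrementLaw, integral_map (f := fun u : ℝ => u) hm.aemeasurable
        aestronglyMeasurable_id] at h
    · exact (integrable_map_measure aestronglyMeasurable_id hm.aemeasurable).2
        (integrable_increment hL (hC x y))
  -- The mean increment at one fixed high `y₀` serves as majorant: unlike the mean of `H x`, it is
  -- known to be measurable in `x`. Two errors of `κ / 16` make up `δ = κ / 8`. If no such `y₀`
  -- exists, the drift bound is vacuous and a constant will do.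
  by_cases hy : ∃ y, N ≤ L y
  · obtain ⟨y₀, hy₀⟩ := hy
    have hm : Measurable fun x => ∫ z, (L z.2 - L y₀) ∂(P (x, y₀)) := by
      have h1 : StronglyMeasurable fun q : X × Y => ∫ z, (L z.2 - L y₀) ∂(P q) :=
        StronglyMeasurable.integral_kernel
          ((hL.comp measurable_snd).sub_const _).stronglyMeasurable
      exact h1.measurable.comp (measurable_id.prodMk measurable_const)
    refine ⟨κ / 8, C, N, fun x => ∫ z, (L z.2 - L y₀) ∂(P (x, y₀)), by positivity, hm,
      fun x => abs_integral_increment_le hC0 (hC x y₀), ?_, ?_⟩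
    -- A non-integrable function has Bochner integral 0, which `hneg` excludes.
    · have hi1 : Integrable (fun x => ∫ u, u ∂(H x)) π := by
        by_contra h
        rw [integral_undef h] at hneg
        exact lt_irrefl _ hneg
      have hi2 : Integrable (fun x => ∫ z, (L z.2 - L y₀) ∂(P (x, y₀))) π :=
        Integrable.of_bound hm.aestronglyMeasurable C
          (Eventually.of_forall fun x => abs_integral_increment_le hC0 (hC x y₀))
      have := integral_mono hi2 (hi1.add (integrable_const (κ / 16))) fun x => by
        have := (abs_le.1 (hclose x y₀ hy₀)).2
        simp only [Pi.add_apply]; linarith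
      simp only [Pi.add_apply] at this
      rw [integral_add hi1 (integrable_const _)] at this
      simp only [integral_const, probReal_univ, smul_eq_mul, one_mul] at this
      linarith
    · intro x y hy
      have h1 := (abs_le.1 (hclose x y₀ hy₀)).1
      have h2 := (abs_le.1 (hclose x y hy)).2
      simp only
      linarith
  · push Not at hy
    refine ⟨κ / 8, κ, N, fun _ => -κ, by positivity, measurable_const,
      fun _ => by rw [abs_neg, abs_of_pos hκ0], ?_, fun x y h => absurd h (not_le.2 (hy y))⟩
    simp only [integral_const, probReal_univ, smul_eq_mul, one_mul]
    linarith

end Drift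

/-! ### The Lyapunov function of the pair -/

lemma exists_nat_measure_lt {X : Type*} [MeasurableSpace X] {π : Measure X} [IsFiniteMeasure π]
    {r : X → ℝ≥0∞} (hr : Measurable r) (hrt : ∀ᵐ x ∂π, r x ≠ ⊤) {ε : ℝ≥0∞} (hε : 0 < ε) :
    ∃ n : ℕ, π {x | (n : ℝ≥0∞) < r x} < ε := by
  have hlim := tendsto_measure_iInter_atTop (μ := π) (s := fun n : ℕ => {x | (n : ℝ≥0∞) < r x})
    (fun n => (measurableSet_lt measurable_const hr).nullMeasurableSet)
    (fun i j hij x (hx : (j : ℝ≥0∞) < r x) => lt_of_le_of_lt (by exact_mod_cast hij) hx)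
    ⟨0, measure_ne_top _ _⟩
  have hset : ⋂ n : ℕ, {x | (n : ℝ≥0∞) < r x} = {x | ¬ r x ≠ ⊤} := by
    ext x
    simp only [Set.mem_iInter, Set.mem_ofPred_eq, not_not]
    refine ⟨fun h => ?_, fun h n => h ▸ ENNReal.natCast_lt_top n⟩
    by_contra hx
    obtain ⟨n, hn⟩ := ENNReal.exists_nat_gt hx
    exact absurd (h n) (not_lt.2 hn.le)
  rw [hset, ae_iff.1 hrt] at hlim
  exact (hlim.eventually (gt_mem_nhds hε)).exists

/-- A Lyapunov function for the pair, made of `L` and a solution of the Poisson inequality for the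
first component. -/
lemma exists_lyapunov {X Y : Type*} [MeasurableSpace X] [MeasurableSpace Y]
    {P : Kernel (X × Y) (X × Y)} [IsMarkovKernel P] {PX : Kernel X X} [IsMarkovKernel PX]
    (hauto : ∀ x y, (P (x, y)).map Prod.fst = PX x)
    {V : Set X} (hVm : MeasurableSet V)
    (hV : ∀ x, Tendsto (fun k => avoidProb PX V k x) atTop (𝓝 0)) {T : ℝ≥0∞} (hTt : T ≠ ⊤)
    (hT : ∀ x ∈ V, meanReturn PX V x ≤ T) (hmin : HasMinorant PX V)
    {π : Measure X} [IsProbabilityMeasure π] (hπ : PX.Invariant π)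
    {L : Y → ℝ} (hL0 : ∀ y, 0 ≤ L y) (hL : Measurable L) {C : ℝ} (hC0 : 0 ≤ C)
    (hC : ∀ x y, ∫⁻ z, ENNReal.ofReal |L z.2 - L y| ∂(P (x, y)) ≤ ENNReal.ofReal C)
    {H : X → Measure ℝ}
    (hLone : Tendsto (fun y => ⨆ x, lOneDist (incrementLaw P L x y) (H x)) (comap L atTop) (𝓝 0))
    (hneg : ∫ x, ∫ u, u ∂(H x) ∂π < 0) :
    ∃ (G : X → ℝ≥0∞) (δ B β a : ℝ≥0∞) (M : ℕ) (N : ℝ), Measurable G ∧ δ ≠ 0 ∧ δ ≠ ⊤ ∧ B ≠ ⊤ ∧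
      β ≠ ⊤ ∧ a ≠ ⊤ ∧ (∀ x, G x ≤ β * meanReturn PX V x + a) ∧
      (∀ x y, ∫⁻ z, (ENNReal.ofReal (L z.2) + G z.1) ∂(P (x, y))
        ≤ ENNReal.ofReal (L y) + G x + B) ∧
      ∀ x y, ¬ (meanReturn PX V x ≤ M ∧ L y ≤ N) →
        ∫⁻ z, (ENNReal.ofReal (L z.2) + G z.1) ∂(P (x, y)) + δ ≤ ENNReal.ofReal (L y) + G x := by
  obtain ⟨δ, A, N, h, hδ, hhm, hhA, hhπ, hdrift⟩ := exists_drift_majorant hL hC0 hC hLone hneg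
  have hrm := measurable_meanReturn (P := PX) hVm
  obtain ⟨x₁⟩ : Nonempty X := nonempty_of_isProbabilityMeasure π
  have hA0 : 0 ≤ A := (abs_nonneg _).trans (hhA x₁)
  -- The shift `c` makes `h + c + 2δ` nonnegative. The penalty `E` pays for the worst increment `C`,
  -- the shift and a gain `δ`.
  set c : ℝ := A + 2 * δ with hc
  set E : ℝ≥0∞ := ENNReal.ofReal (c + C + δ) with hE
  have hE0 : E ≠ 0 := by
    rw [hE, ne_eq, ENNReal.ofReal_eq_zero, not_le]; positivity
  have hEt : E ≠ ⊤ := ENNReal.ofReal_ne_top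
  obtain ⟨M, hM⟩ := exists_nat_measure_lt (π := π) hrm (ae_meanReturn_ne_top hVm hV hTt hT hπ)
    (ε := ENNReal.ofReal δ / E)
    (ENNReal.div_pos (by simpa using hδ) hEt)
  set S : Set X := {x | (M : ℝ≥0∞) < meanReturn PX V x} with hS
  have hSm : MeasurableSet S := measurableSet_lt measurable_const hrm
  -- Of the `2δ`, one `δ` covers the error of the majorant `h` and one is the drift gained. The mean
  -- of `b` stays below `c`: the first term has mean at most `c - 2δ`, and `M` was chosen so that
  -- the penalty adds less than `δ`.
  set b : X → ℝ≥0∞ := fun x => ENNReal.ofReal (h x + c + 2 * δ) + S.indicator (fun _ => E) x with hb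
  have hb1 : Measurable fun x => ENNReal.ofReal (h x + c + 2 * δ) :=
    ((hhm.add_const _).add_const _).ennreal_ofReal
  have hbm : Measurable b := hb1.add (measurable_const.indicator hSm)
  have hbβ : ∀ x, b x ≤ ENNReal.ofReal (A + c + 2 * δ) + E := fun x =>
    add_le_add (ENNReal.ofReal_le_ofReal (by linarith [(abs_le.1 (hhA x)).2]))
      (Set.indicator_le_self _ _ _)
  have hnn : ∀ x, 0 ≤ h x + c + 2 * δ := fun x => by
    have := (abs_le.1 (hhA x)).1
    rw [hc]; linarith
  have hbc : ∫⁻ x, b x ∂π < ENNReal.ofReal c := by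
    have hi : Integrable h π :=
      Integrable.of_bound hhm.aestronglyMeasurable A (Eventually.of_forall hhA)
    have h1 : ∫⁻ x, ENNReal.ofReal (h x + c + 2 * δ) ∂π ≤ ENNReal.ofReal (c - 2 * δ) := by
      rw [← ofReal_integral_eq_lintegral_ofReal (f := fun x => h x + c + 2 * δ)
        ((hi.add (integrable_const c)).add (integrable_const (2 * δ))) (Eventually.of_forall hnn)]
      refine ENNReal.ofReal_le_ofReal ?_
      have : ∫ x, (h x + c + 2 * δ) ∂π = ∫ x, h x ∂π + c + 2 * δ := by
        rw [integral_add (f := fun x => h x + c) (hi.add (integrable_const c)) (integrable_const _),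
          integral_add hi (integrable_const _)]
        simp
      rw [this]; linarith
    have h2 : E * π S < ENNReal.ofReal δ := by
      rw [mul_comm]
      exact (ENNReal.lt_div_iff_mul_lt (Or.inl hE0) (Or.inl hEt)).1 hM
    calc ∫⁻ x, b x ∂π = ∫⁻ x, ENNReal.ofReal (h x + c + 2 * δ) ∂π + E * π S := by
          rw [hb, lintegral_add_left hb1, lintegral_indicator_const hSm]
      _ < ENNReal.ofReal (c - 2 * δ) + ENNReal.ofReal δ :=
          ENNReal.add_lt_add_of_le_of_lt (ne_top_of_le_ne_top ENNReal.ofReal_ne_top h1) h1 h2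
      _ = ENNReal.ofReal (c - δ) := by
          rw [← ENNReal.ofReal_add (by rw [hc]; linarith) hδ.le]; congr 1; ring
      _ ≤ ENNReal.ofReal c := ENNReal.ofReal_le_ofReal (by linarith)
  obtain ⟨G, a, hGm, hat, hGb, hGa⟩ := exists_poisson_supersolution hVm hV hTt hT hmin hπ hbm hbβ
    (ENNReal.add_ne_top.2 ⟨ENNReal.ofReal_ne_top, hEt⟩) ENNReal.ofReal_ne_top hbc
  have hPW : ∀ x y, ∫⁻ z, (ENNReal.ofReal (L z.2) + G z.1) ∂(P (x, y))
      = ENNReal.ofReal (L y + ∫ z, (L z.2 - L y) ∂(P (x, y))) + ∫⁻ x', G x' ∂(PX x) := by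
    intro x y
    have hm : Measurable fun z : X × Y => ENNReal.ofReal (L z.2) :=
      (hL.comp measurable_snd).ennreal_ofReal
    rw [lintegral_add_left hm, ← lintegral_ofReal_snd_eq hL0 hL (hC x y),
      lintegral_fst_eq hauto hGm]
  have hdC : ∀ x y, ∫ z, (L z.2 - L y) ∂(P (x, y)) ≤ C := fun x y =>
    (abs_le.1 (abs_integral_increment_le hC0 (hC x y))).2
  have hnonneg : ∀ x y, 0 ≤ L y + ∫ z, (L z.2 - L y) ∂(P (x, y)) := fun x y => by
    rw [(add_integral_increment_eq hL (hC x y)).2]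
    exact integral_nonneg fun z => hL0 z.2
  have hc0 : 0 ≤ c := by positivity
  refine ⟨G, ENNReal.ofReal δ, ENNReal.ofReal C + ENNReal.ofReal c,
    ENNReal.ofReal (A + c + 2 * δ) + E, a, M, N, hGm, by simpa using hδ, ENNReal.ofReal_ne_top,
    ENNReal.add_ne_top.2 ⟨ENNReal.ofReal_ne_top, ENNReal.ofReal_ne_top⟩,
    ENNReal.add_ne_top.2 ⟨ENNReal.ofReal_ne_top, hEt⟩, hat, hGa, ?_, ?_⟩
  · intro x y
    rw [hPW]
    calc ENNReal.ofReal (L y + ∫ z, (L z.2 - L y) ∂(P (x, y))) + ∫⁻ x', G x' ∂(PX x)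
        ≤ (ENNReal.ofReal (L y) + ENNReal.ofReal C) + (G x + ENNReal.ofReal c) := by
          refine add_le_add ?_ (le_add_self.trans (hGb x))
          rw [← ENNReal.ofReal_add (hL0 y) hC0]
          exact ENNReal.ofReal_le_ofReal (by linarith [hdC x y])
      _ = _ := by ring
  · intro x y hxy
    have key : ENNReal.ofReal (L y + ∫ z, (L z.2 - L y) ∂(P (x, y))) + ENNReal.ofReal δ
        + ENNReal.ofReal c ≤ ENNReal.ofReal (L y) + b x := by
      rw [← ENNReal.ofReal_add (hnonneg x y) hδ.le,
        ← ENNReal.ofReal_add (add_nonneg (hnonneg x y) hδ.le) hc0]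
      by_cases hx : x ∈ S
      · refine le_trans ?_ (add_le_add_right (le_add_self : S.indicator (fun _ => E) x ≤ b x) _)
        rw [Set.indicator_of_mem hx, hE, ← ENNReal.ofReal_add (hL0 y) (by positivity)]
        exact ENNReal.ofReal_le_ofReal (by linarith [hdC x y])
      · have hy : N ≤ L y := by
          by_contra! hy
          exact hxy ⟨not_lt.1 hx, hy.le⟩
        refine le_trans ?_ (add_le_add_right
          (le_self_add : ENNReal.ofReal (h x + c + 2 * δ) ≤ b x) _)
        rw [← ENNReal.ofReal_add (hL0 y) (hnn x)]
        exact ENNReal.ofReal_le_ofReal (by linarith [hdrift x y hy])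
    rw [hPW]
    refine (ENNReal.add_le_add_iff_right (ENNReal.ofReal_ne_top (r := c))).1 ?_
    calc ENNReal.ofReal (L y + ∫ z, (L z.2 - L y) ∂(P (x, y))) + ∫⁻ x', G x' ∂(PX x)
          + ENNReal.ofReal δ + ENNReal.ofReal c
        = ENNReal.ofReal (L y + ∫ z, (L z.2 - L y) ∂(P (x, y))) + ENNReal.ofReal δ
          + ENNReal.ofReal c + ∫⁻ x', G x' ∂(PX x) := by ring
      _ ≤ ENNReal.ofReal (L y) + b x + ∫⁻ x', G x' ∂(PX x) := by gcongr
      _ = ENNReal.ofReal (L y) + (b x + ∫⁻ x', G x' ∂(PX x)) := by ring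
      _ ≤ ENNReal.ofReal (L y) + (G x + ENNReal.ofReal c) :=
          add_le_add_right (hGb x) _
      _ = _ := by ring

end AveragingLyapunov

/-! ### The theorem -/

open AveragingLyapunov in
theorem corollary1
    {X Y : Type*} [MeasurableSpace X] [MeasurableSpace Y]
    [MeasurableSpace.CountablyGenerated X] [MeasurableSpace.CountablyGenerated Y]
    -- the chain `(X^t, Y^t)` and its autonomous first component
    (P : Kernel (X × Y) (X × Y)) [IsMarkovKernel P]
    (PX : Kernel X X) [IsMarkovKernel PX]
    (hauto : ∀ x y, (P (x, y)).map Prod.fst = PX x)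
    -- the chain `X^t` is aperiodic, with a positive recurrent set that admits a minorant measure
    (hper : AveragingLyapunov.Aperiodic PX)
    (V : Set X) (hrec : AveragingLyapunov.PositiveRecurrentSet PX V)
    (hmin : AveragingLyapunov.HasMinorant PX V)
    -- `π` is the stationary distribution of `X^t`
    (π : Measure X) [IsProbabilityMeasure π] (hπ : PX.Invariant π)
    -- the test function, with increments of bounded mean
    (L₂ : Y → ℝ) (hL_nonneg : ∀ y, 0 ≤ L₂ y) (hL_meas : Measurable L₂)
    (hB1 : ⨆ (x : X) (y : Y), ∫⁻ z, ENNReal.ofReal |L₂ z.2 - L₂ y| ∂(P (x, y)) < ⊤)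
    -- as `L₂ y → ∞`, the laws of the increments converge weakly and in `L_1`, uniformly in `x`
    (H : X → Measure ℝ) (hH : ∀ x, IsProbabilityMeasure (H x))
    (hweak : Tendsto
      (fun y => ⨆ x, levyProkhorovEDist (AveragingLyapunov.incrementLaw P L₂ x y) (H x))
      (comap L₂ atTop) (𝓝 0))
    (hLone : Tendsto
      (fun y => ⨆ x, AveragingLyapunov.lOneDist (AveragingLyapunov.incrementLaw P L₂ x y) (H x))
      (comap L₂ atTop) (𝓝 0))
    -- the limiting laws have negative mean drift in the stationary regime
    (hneg : ∫ x, ∫ u, u ∂(H x) ∂π < 0) :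
    ∃ N₀ : ℝ, AveragingLyapunov.PositiveRecurrentSet P (V ×ˢ {y | L₂ y ≤ N₀}) := by
  obtain ⟨hVm, hV, hVT⟩ := (positiveRecurrentSet_iff PX).1 hrec
  set T := ⨆ z ∈ V, meanReturn PX V z with hTdef
  have hT : ∀ x ∈ V, meanReturn PX V x ≤ T := fun x hx =>
    le_iSup₂ (f := fun x (_ : x ∈ V) => meanReturn PX V x) x hx
  set C : ℝ := (⨆ (x : X) (y : Y), ∫⁻ z, ENNReal.ofReal |L₂ z.2 - L₂ y| ∂(P (x, y))).toReal
    with hCdef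
  have hC0 : 0 ≤ C := ENNReal.toReal_nonneg
  have hC : ∀ x y, ∫⁻ z, ENNReal.ofReal |L₂ z.2 - L₂ y| ∂(P (x, y)) ≤ ENNReal.ofReal C :=
    fun x y => by
      rw [hCdef, ENNReal.ofReal_toReal hB1.ne]
      exact le_iSup₂ (f := fun x y => ∫⁻ z, ENNReal.ofReal |L₂ z.2 - L₂ y| ∂(P (x, y))) x y
  obtain ⟨G, δ, B, β, a, M, N, hGm, hδ0, hδt, hBt, hβt, hat, hGa, hgrow, hdrift⟩ :=
    exists_lyapunov hauto hVm hV hVT.ne hT hmin hπ hL_nonneg hL_meas hC0 hC hLone hneg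
  -- On the exceptional set, avoiding `V` for `s` steps has probability at most `M / s < 1/4`, and
  -- `N₀` makes the Markov term `(N + s C) / N₀` at most 1/4. The final `+ 1` keeps `N₀` positive.
  set s : ℕ := 4 * (M + 1) with hs
  set N₀ : ℝ := 4 * (|N| + s * C) + 1 with hN₀
  have hN₀pos : 0 < N₀ := by positivity
  have hDm : MeasurableSet (V ×ˢ {y | L₂ y ≤ N₀}) :=
    hVm.prod (measurableSet_le hL_meas measurable_const)
  have hLgrow : ∀ x y, ∫⁻ z, ENNReal.ofReal (L₂ z.2) ∂(P (x, y))
      ≤ ENNReal.ofReal (L₂ y) + ENNReal.ofReal C := fun x y => by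
    rw [lintegral_ofReal_snd_eq hL_nonneg hL_meas (hC x y),
      ← ENNReal.ofReal_add (hL_nonneg y) hC0]
    exact ENNReal.ofReal_le_ofReal
      (by linarith [(abs_le.1 (abs_integral_increment_le hC0 (hC x y))).2])
  have hquarter : (4 : ℝ≥0∞)⁻¹ + 4⁻¹ = 2⁻¹ := by
    rw [← ENNReal.toReal_eq_toReal_iff' (by simp) (by simp), ENNReal.toReal_add (by simp) (by simp)]
    norm_num
  have havoid : ∀ z : X × Y, z ∈ {z : X × Y | meanReturn PX V z.1 ≤ M ∧ L₂ z.2 ≤ N} →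
      avoidProb P (V ×ˢ {y | L₂ y ≤ N₀}) s z ≤ 2⁻¹ := by
    rintro ⟨x, y⟩ ⟨hx, hy⟩
    refine (avoidProb_prod_le hauto hVm hL_meas hLgrow hN₀pos s x y).trans ?_
    rw [← hquarter]
    refine add_le_add ?_ ?_
    · have h1 := (nat_mul_avoidProb_le_meanReturn (P := PX) (D := V) s x).trans hx
      by_contra! hlt
      have h2 : (s : ℝ≥0∞) * 4⁻¹ ≤ M := le_trans (by gcongr) h1
      have h3 : (s : ℝ≥0∞) * 4⁻¹ = (M + 1 : ℕ) := by
        rw [hs, Nat.cast_mul, mul_right_comm, Nat.cast_ofNat,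
          ENNReal.mul_inv_cancel (by norm_num) (by norm_num), one_mul]
      rw [h3, Nat.cast_le] at h2
      omega
    · refine ENNReal.div_le_of_le_mul ?_
      have h4 : (4 : ℝ≥0∞)⁻¹ = ENNReal.ofReal (1 / 4) := by
        rw [ENNReal.ofReal_div_of_pos (by norm_num)]; simp
      rw [h4, ← ENNReal.ofReal_mul (by norm_num), ← ENNReal.ofReal_natCast,
        ← ENNReal.ofReal_mul (by positivity), ← ENNReal.ofReal_add (hL_nonneg y) (by positivity)]
      refine ENNReal.ofReal_le_ofReal ?_
      have hy' : L₂ y ≤ N := hy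
      rw [hN₀]
      linarith [le_abs_self N]
  have hWm : Measurable fun z : X × Y => ENNReal.ofReal (L₂ z.2) + G z.1 :=
    (hL_meas.comp measurable_snd).ennreal_ofReal.add (hGm.comp measurable_fst)
  obtain ⟨Q, hQt, hQ⟩ := exists_meanReturn_le_of_drift
    (S := {z : X × Y | meanReturn PX V z.1 ≤ M ∧ L₂ z.2 ≤ N}) hDm hWm hδ0 hδt hBt
    (w := ENNReal.ofReal N + (β * M + a))
    (ENNReal.add_ne_top.2 ⟨ENNReal.ofReal_ne_top, ENNReal.add_ne_top.2
      ⟨ENNReal.mul_ne_top hβt (ENNReal.natCast_ne_top M), hat⟩⟩)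
    (fun z hz => hdrift z.1 z.2 hz) (fun z => hgrow z.1 z.2)
    (fun z hz => add_le_add (ENNReal.ofReal_le_ofReal hz.2)
      ((hGa z.1).trans (by gcongr; exact hz.1))) havoid
  have hGV : ∀ x ∈ V, G x ≤ β * T + a := fun x hx => (hGa x).trans (by gcongr; exact hT x hx)
  have hGVt : β * T + a ≠ ⊤ := ENNReal.add_ne_top.2 ⟨ENNReal.mul_ne_top hβt hVT.ne, hat⟩
  have hδi : δ⁻¹ ≠ ⊤ := ENNReal.inv_ne_top.2 hδ0
  refine ⟨N₀, (positiveRecurrentSet_iff P).2 ⟨hDm,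
    tendsto_avoidProb_of_fst hauto hVm hDm hV fun z hz => ?_, ?_⟩⟩
  -- Over `V` the corrector is bounded, so the mean return time is finite at every height `L₂ y`; a
  -- convergent series has terms tending to 0.
  · have hfin : meanReturn P (V ×ˢ {y | L₂ y ≤ N₀}) z ≠ ⊤ := by
      refine ne_top_of_le_ne_top (ENNReal.add_ne_top.2 ⟨ENNReal.mul_ne_top hδi
        (ENNReal.add_ne_top.2 ⟨ENNReal.ofReal_ne_top, ?_⟩), hQt⟩) (hQ z)
      exact ne_top_of_le_ne_top hGVt (hGV z.1 hz)
    exact ENNReal.tendsto_atTop_zero_of_tsum_ne_top hfin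
  · have hb : ⨆ z ∈ V ×ˢ {y | L₂ y ≤ N₀}, meanReturn P (V ×ˢ {y | L₂ y ≤ N₀}) z
        ≤ δ⁻¹ * (ENNReal.ofReal N₀ + (β * T + a)) + Q := by
      refine iSup₂_le fun z hz => (hQ z).trans ?_
      gcongr
      · exact hz.2
      · exact hGV z.1 hz.1
    exact hb.trans_lt (ENNReal.add_ne_top.2 ⟨ENNReal.mul_ne_top hδi
      (ENNReal.add_ne_top.2 ⟨ENNReal.ofReal_ne_top, hGVt⟩), hQt⟩).lt_top
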